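/- Let $(N,g)$ be a smooth finite-dimensional Riemannian manifold without boundary, with Levi-Civita connection $\nabla$, let $M$ be a smooth submanifold of $N$ (a smooth manifold without boundary with an injective immersion $M\to N$), and let $x\in M$. For a piecewise smooth loop $\gamma:[0,1]\to M$ based at $x$, let $P_\gamma:T_xN\to T_xN$ be the parallel transport along $\gamma$ with respect to $\nabla$, and let $G=Hol_x(N,M)$ be the group of linear automorphisms of $T_xN$ generated by all these $P_\gamma$. For $W\in T_xN$ let $G_W=\{P\in G: PW=W\}$. A parallel vector field along $M$ is a smooth map $X:M\to TN$ with $X(p)\in T_pN$ for all $p\in M$ and $\nabla_w X=0$ for all $w\in TM$. (a) For every $W\in T_xN$, there exists a parallel vector field $X$ along $M$ with $X(x)=W$ if and only if $G_W=G$. (b) If $M$ is connected, there exists a parallel vector field along $M$ that is not identically zero if and only if there exists $W\in T_xN$, $W\neq 0$, with $G_W=G$. -/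

import Mathlib

open Bundle Manifold Set
open scoped ContDiff Topology

noncomputable section

namespace ParallelAlong

variable {E : Type*} [NormedAddCommGroup E] [NormedSpace ℝ E] [FiniteDimensional ℝ E]
  {N : Type*} [TopologicalSpace N] [ChartedSpace E N] [IsManifold 𝓘(ℝ, E) ∞ N]

/-- `∇` is the Levi-Civita connection of the Riemannian manifold `N`: a smooth connection on `TN`
which is compatible with the metric and torsion-free. -/
structure IsLeviCivita [RiemannianBundle (fun y : N ↦ TangentSpace 𝓘(ℝ, E) y)]
    [IsContMDiffRiemannianBundle 𝓘(ℝ, E) ∞ E (fun y : N ↦ TangentSpace 𝓘(ℝ, E) y)]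
    (nabla : CovariantDerivative 𝓘(ℝ, E) E (fun y : N ↦ TangentSpace 𝓘(ℝ, E) y)) : Prop where
  smooth : nabla.ContMDiffCovariantDerivative ∞
  metric : CovariantDerivative.IsMetricCompatible (V := fun y : N ↦ TangentSpace 𝓘(ℝ, E) y) nabla
  torsion_free : nabla.torsion = 0

section Along

variable {F : Type*} [NormedAddCommGroup F] [NormedSpace ℝ F]
  {M : Type*} [TopologicalSpace M] [ChartedSpace F M]

/-- The induced covariant derivative `∇_w Y` at `p` of a vector field `Y : M → TN` along the map
`f = π ∘ Y : M → N`, all derivatives on `M` being taken within the set `s`.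
In the standard trivialization of `TN` around `f p`, with its constant frame `e₁, …, eₙ`, write
`Y = ∑ Yⁱ (eᵢ ∘ f)`; then `∇_w Y = ∑ dYⁱ(w) eᵢ + ∑ Yⁱ(p) ∇_{df(w)} eᵢ`. The first sum is the
first summand below; the second one is the derivative in the direction `df(w)` of `∑ Yⁱ(p) eᵢ`,
the extension of `Y p` which is constant in the trivialization (`FiberBundle.extend`). -/
def covDerivWithin (nabla : CovariantDerivative 𝓘(ℝ, E) E (fun y : N ↦ TangentSpace 𝓘(ℝ, E) y))
    (Y : M → TangentBundle 𝓘(ℝ, E) N) (s : Set M) (p : M) (w : TangentSpace 𝓘(ℝ, F) p) :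
    TangentSpace 𝓘(ℝ, E) (Y p).proj :=
  (trivializationAt E (TangentSpace 𝓘(ℝ, E)) (Y p).proj).symm (Y p).proj
      (mvfderivWithin 𝓘(ℝ, F)
        (fun q ↦ (trivializationAt E (TangentSpace 𝓘(ℝ, E)) (Y p).proj (Y q)).2) s p w)
    + nabla (FiberBundle.extend E (Y p).2) (Y p).proj
      (mfderivWithin 𝓘(ℝ, F) 𝓘(ℝ, E) (fun q ↦ (Y q).proj) s p w)

/-- `X : M → TN` is a (smooth) vector field along `f : M → N` which is parallel along `M`:
`∇_w X = 0` for every `w ∈ TM`. -/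
structure IsParallelField
    (nabla : CovariantDerivative 𝓘(ℝ, E) E (fun y : N ↦ TangentSpace 𝓘(ℝ, E) y))
    (f : M → N) (X : M → TangentBundle 𝓘(ℝ, E) N) : Prop where
  proj_eq : ∀ p, (X p).proj = f p
  smooth : ContMDiff 𝓘(ℝ, F) (𝓘(ℝ, E).prod 𝓘(ℝ, E)) ∞ X
  parallel : ∀ (p : M) (w : TangentSpace 𝓘(ℝ, F) p), covDerivWithin nabla X univ p w = 0

end Along

/-- There is a subdivision `0 = t₀ < t₁ < ⋯ < tₙ = 1` such that `P` holds for each of the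
intervals `[tᵢ, tᵢ₊₁]`. -/
def OnPieces (P : Set ℝ → Prop) : Prop :=
  ∃ (n : ℕ) (t : Fin (n + 1) → ℝ), StrictMono t ∧ t 0 = 0 ∧ t (Fin.last n) = 1 ∧
    ∀ i : Fin n, P (Icc (t i.castSucc) (t i.succ))

/-- A vector field `V` along the curve `c : [0, 1] → N` is parallel: it is piecewise smooth (hence
continuous, the pieces being closed intervals) and `∇_{d/dt} V = 0` on each of the pieces.
Values outside of `[0, 1]` are irrelevant. -/
structure IsParallelAlongCurve
    (nabla : CovariantDerivative 𝓘(ℝ, E) E (fun y : N ↦ TangentSpace 𝓘(ℝ, E) y))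
    (c : ℝ → N) (V : ℝ → TangentBundle 𝓘(ℝ, E) N) : Prop where
  proj_eq : ∀ t ∈ Icc (0 : ℝ) 1, (V t).proj = c t
  parallel : OnPieces fun s ↦ ContMDiffOn 𝓘(ℝ, ℝ) (𝓘(ℝ, E).prod 𝓘(ℝ, E)) ∞ V s ∧
    ∀ t ∈ s, covDerivWithin (F := ℝ) nabla V s t (1 : ℝ) = 0

section Holonomy

variable {F : Type*} [NormedAddCommGroup F] [NormedSpace ℝ F]
  {M : Type*} [TopologicalSpace M] [ChartedSpace F M]

/-- The path `γ : [0, 1] → M` is piecewise smooth. -/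
def IsPiecewiseSmooth {x y : M} (γ : Path x y) : Prop :=
  OnPieces fun s ↦ ContMDiffOn 𝓘(ℝ, ℝ) 𝓘(ℝ, F) ∞ γ.extend s

/-- `P` is the parallel transport `P_γ : T_{f x} N → T_{f y} N` along the image in `N` of the path
`γ` of `M`: for each `v`, some parallel field along `f ∘ γ` starts at `v` and ends at `P v`. -/
def IsParallelTransport
    (nabla : CovariantDerivative 𝓘(ℝ, E) E (fun y : N ↦ TangentSpace 𝓘(ℝ, E) y))
    (f : M → N) {x y : M} (γ : Path x y)
    (P : TangentSpace 𝓘(ℝ, E) (f x) ≃ₗ[ℝ] TangentSpace 𝓘(ℝ, E) (f y)) : Prop :=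
  ∀ v : TangentSpace 𝓘(ℝ, E) (f x), ∃ V : ℝ → TangentBundle 𝓘(ℝ, E) N,
    IsParallelAlongCurve nabla (fun t ↦ f (γ.extend t)) V ∧
      V 0 = ⟨f x, v⟩ ∧ V 1 = ⟨f y, P v⟩

/-- The holonomy subgroup `Hol_x(N, M)`: the group of the parallel transports `P_γ` in `N` along
the piecewise smooth loops `γ` of `M` based at `x`. -/
def relHolonomy (nabla : CovariantDerivative 𝓘(ℝ, E) E (fun y : N ↦ TangentSpace 𝓘(ℝ, E) y))
    (f : M → N) (x : M) :
    Subgroup (TangentSpace 𝓘(ℝ, E) (f x) ≃ₗ[ℝ] TangentSpace 𝓘(ℝ, E) (f x)) :=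
  Subgroup.closure {P | ∃ γ : Path x x, IsPiecewiseSmooth (F := F) γ ∧
    IsParallelTransport nabla f γ P}

end Holonomy

end ParallelAlong

end

/-! In a trivialization of `TN`, the equation `∇_w X = 0` along `f` becomes a linear total
differential equation `du = A(·)(u)` in a chart of `M`, and along a curve it becomes a linear ODE.

If `X` is parallel, its restriction to a piecewise smooth loop and the field defining `P_γ` solve
the same linear ODE on each piece, so uniqueness gives `P_γ (X x) = X x`
(`IsParallelField.eq_of_isPathTransport`). Checking the generators of the holonomy group is enough.

Conversely, let `W` be fixed by the holonomy group. Transporting `W` from `x` along paths gives a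
well-defined field `transportField` (`TransportJoined.apply_eq`), set to zero where no transport
reaches. In a small chart ball, transport along straight segments exists and carries the field to
itself, so the field satisfies the equation along every segment of the ball. This forces Fréchet
differentiability with derivative `A y (u y)` (`hasFDerivAt_of_forall_segment`), and bootstrapping
gives smoothness. Path independence is given, so no curvature condition enters.

On a connected `M` any two points are joined by chains of such segments, so a parallel field
vanishing at `x` vanishes everywhere; this gives (b). -/

namespace ParallelAlong

/-! ### Linear ordinary differential equations on an interval. -/

section LinearODE

variable {E : Type*} [NormedAddCommGroup E] [NormedSpace ℝ E]

/-- The bound `1 / 2` makes one Picard–Lindelöf step cover `[0, 1]`: on the ball of radius `‖v‖`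
around `v` vectors have norm at most `2 * ‖v‖`, so the speed is at most `‖v‖` and the solution stays
in the ball up to time one. -/
theorem exists_hasDerivWithinAt_linear [CompleteSpace E] {B : ℝ → E →L[ℝ] E}
    (hB : ContinuousOn B (Icc 0 1)) (hB' : ∀ t ∈ Icc (0 : ℝ) 1, ‖B t‖ ≤ 1 / 2) (v : E) :
    ∃ u : ℝ → E, u 0 = v ∧
      ∀ t ∈ Icc (0 : ℝ) 1, HasDerivWithinAt u (B t (u t)) (Icc 0 1) t := by
  have h : IsPicardLindelof (fun t x ↦ B t x) (tmin := 0) (tmax := 1) ⟨0, by simp⟩ v ‖v‖₊ 0 ‖v‖₊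
      (1 / 2) := by
    refine ⟨fun t ht ↦ ?_, fun x _ ↦ hB.clm_apply continuousOn_const, fun t ht x hx ↦ ?_, ?_⟩
    · refine ((B t).lipschitz.weaken ?_).lipschitzOnWith
      exact_mod_cast hB' t ht
    · have hx' : ‖x‖ ≤ 2 * ‖v‖ := by
        have := norm_le_norm_add_norm_sub' x v
        rw [mem_closedBall_iff_norm] at hx
        simp only [coe_nnnorm] at hx
        linarith
      calc ‖B t x‖ ≤ ‖B t‖ * ‖x‖ := (B t).le_opNorm x
        _ ≤ 1 / 2 * (2 * ‖v‖) := by gcongr; exact hB' t ht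
        _ = _ := by simp
    · simp
  exact h.exists_eq_forall_mem_Icc_hasDerivWithinAt₀

theorem hasDerivWithinAt_Ici_of_Icc {u : ℝ → E} {u' : E} {a b t : ℝ}
    (h : HasDerivWithinAt u u' (Icc a b) t) (ht : t ∈ Ico a b) : HasDerivWithinAt u u' (Ici t) t :=
  (h.mono_of_mem_nhdsWithin (Icc_mem_nhdsGE_of_mem ht))

theorem hasDerivWithinAt_Iic_of_Icc {u : ℝ → E} {u' : E} {a b t : ℝ}
    (h : HasDerivWithinAt u u' (Icc a b) t) (ht : t ∈ Ioc a b) : HasDerivWithinAt u u' (Iic t) t :=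
  (h.mono_of_mem_nhdsWithin (Icc_mem_nhdsLE_of_mem ht))

theorem norm_le_exp_of_hasDerivWithinAt_linear {B : ℝ → E →L[ℝ] E} {K : ℝ}
    (hB : ∀ t ∈ Icc (0 : ℝ) 1, ‖B t‖ ≤ K) {u : ℝ → E}
    (hu : ∀ t ∈ Icc (0 : ℝ) 1, HasDerivWithinAt u (B t (u t)) (Icc 0 1) t) :
    ∀ t ∈ Icc (0 : ℝ) 1, ‖u t‖ ≤ ‖u 0‖ * Real.exp K := by
  intro t ht
  have hK : 0 ≤ K := (norm_nonneg _).trans (hB 0 (by simp))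
  have := norm_le_gronwallBound_of_norm_deriv_right_le (f := u) (f' := fun t ↦ B t (u t))
    (δ := ‖u 0‖) (K := K) (ε := 0) (a := 0) (b := 1) (fun t ht ↦ (hu t ht).continuousWithinAt)
    (fun t ht ↦ hasDerivWithinAt_Ici_of_Icc (hu t (Ico_subset_Icc_self ht)) ht) le_rfl
    (fun t ht ↦ by
      rw [add_zero]
      exact (B t).le_of_opNorm_le (hB t (Ico_subset_Icc_self ht)) _) t ht
  rw [gronwallBound_ε0] at this
  refine this.trans ?_
  gcongr
  simpa using mul_le_mul_of_nonneg_left ht.2 hK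

theorem eqOn_of_hasDerivWithinAt_linear {B : ℝ → E →L[ℝ] E} {a b t₀ : ℝ}
    (hB : ContinuousOn B (Icc a b)) {u v : ℝ → E}
    (hu : ∀ t ∈ Icc a b, HasDerivWithinAt u (B t (u t)) (Icc a b) t)
    (hv : ∀ t ∈ Icc a b, HasDerivWithinAt v (B t (v t)) (Icc a b) t)
    (ht₀ : t₀ ∈ Icc a b) (h : u t₀ = v t₀) : EqOn u v (Icc a b) := by
  obtain ⟨K, hK⟩ := isCompact_Icc.exists_bound_of_continuousOn hB
  have hL : ∀ t ∈ Icc a b, LipschitzOnWith K.toNNReal (fun x ↦ B t x) univ := fun t ht ↦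
    ((B t).lipschitz.weaken (by
      rw [← NNReal.coe_le_coe]
      exact (hK t ht).trans (Real.le_coe_toNNReal K))).lipschitzOnWith
  have hL' : Icc a t₀ ⊆ Icc a b := Icc_subset_Icc_right ht₀.2
  have hR' : Icc t₀ b ⊆ Icc a b := Icc_subset_Icc_left ht₀.1
  have hcu : ContinuousOn u (Icc a b) := fun t ht ↦ (hu t ht).continuousWithinAt
  have hcv : ContinuousOn v (Icc a b) := fun t ht ↦ (hv t ht).continuousWithinAt
  rw [← Icc_union_Icc_eq_Icc ht₀.1 ht₀.2]
  refine EqOn.union ?_ ?_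
  · exact ODE_solution_unique_of_mem_Icc_left (K := K.toNNReal) (v := fun t x ↦ B t x)
      (s := fun _ ↦ univ)
      (fun t ht ↦ hL t (hL' (Ioc_subset_Icc_self ht))) (hcu.mono hL')
      (fun t ht ↦ hasDerivWithinAt_Iic_of_Icc ((hu t (hL' (Ioc_subset_Icc_self ht))).mono hL') ht)
      (fun _ _ ↦ mem_univ _) (hcv.mono hL')
      (fun t ht ↦ hasDerivWithinAt_Iic_of_Icc ((hv t (hL' (Ioc_subset_Icc_self ht))).mono hL') ht)
      (fun _ _ ↦ mem_univ _) h
  · exact ODE_solution_unique_of_mem_Icc_right (K := K.toNNReal) (v := fun t x ↦ B t x)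
      (s := fun _ ↦ univ)
      (fun t ht ↦ hL t (hR' (Ico_subset_Icc_self ht))) (hcu.mono hR')
      (fun t ht ↦ hasDerivWithinAt_Ici_of_Icc ((hu t (hR' (Ico_subset_Icc_self ht))).mono hR') ht)
      (fun _ _ ↦ mem_univ _) (hcv.mono hR')
      (fun t ht ↦ hasDerivWithinAt_Ici_of_Icc ((hv t (hR' (Ico_subset_Icc_self ht))).mono hR') ht)
      (fun _ _ ↦ mem_univ _) h

/-- The time-one map of a linear differential equation with small coefficients. -/
theorem exists_linearEquiv_flow [FiniteDimensional ℝ E] {B : ℝ → E →L[ℝ] E}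
    (hB : ContinuousOn B (Icc 0 1)) (hB' : ∀ t ∈ Icc (0 : ℝ) 1, ‖B t‖ ≤ 1 / 2) :
    ∃ P : E ≃ₗ[ℝ] E, ∀ v, ∃ u : ℝ → E, u 0 = v ∧ u 1 = P v ∧
      ∀ t ∈ Icc (0 : ℝ) 1, HasDerivWithinAt u (B t (u t)) (Icc 0 1) t := by
  have := FiniteDimensional.complete ℝ E
  choose u hu₀ hu using exists_hasDerivWithinAt_linear hB hB'
  have h0 : (0 : ℝ) ∈ Icc (0 : ℝ) 1 := by simp
  have h1 : (1 : ℝ) ∈ Icc (0 : ℝ) 1 := by simp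
  let P : E →ₗ[ℝ] E :=
    { toFun v := u v 1
      map_add' v w := by
        refine eqOn_of_hasDerivWithinAt_linear (v := u v + u w) hB (hu _) (fun t ht ↦ ?_) h0
          (by simp [hu₀]) h1
        simpa using (hu v t ht).add (hu w t ht)
      map_smul' c v := by
        refine eqOn_of_hasDerivWithinAt_linear (v := c • u v) hB (hu _) (fun t ht ↦ ?_) h0
          (by simp [hu₀]) h1
        simpa using (hu v t ht).const_smul c }
  -- Uniqueness is applied backwards from time one; injectivity then yields an equivalence because
  -- `E` is finite-dimensional.
  have hP : Function.Injective P := fun v w h ↦ by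
    have := eqOn_of_hasDerivWithinAt_linear hB (hu v) (hu w) h1 h h0
    simpa [hu₀] using this
  exact ⟨LinearEquiv.ofInjectiveEndo P hP, fun v ↦ ⟨u v, hu₀ v, rfl, hu v⟩⟩

end LinearODE

/-! ### Regularity for linear total differential equations. -/

section TotalDifferentialEquation

variable {E : Type*} [NormedAddCommGroup E] [NormedSpace ℝ E]
  {D : Type*} [NormedAddCommGroup D] [NormedSpace ℝ D]

/-- Solutions of a smooth linear total differential equation are smooth. -/
theorem contDiffOn_of_hasFDerivWithinAt_linear {A : D → E →L[ℝ] D →L[ℝ] E} {s : Set D}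
    (hs : UniqueDiffOn ℝ s) (hA : ContDiffOn ℝ ∞ A s) {u : D → E}
    (hu : ∀ x ∈ s, HasFDerivWithinAt u (A x (u x)) s x) : ContDiffOn ℝ ∞ u s := by
  rw [contDiffOn_infty]
  intro n
  induction n with
  | zero =>
    rw [Nat.cast_zero, contDiffOn_zero]
    exact fun x hx ↦ (hu x hx).continuousWithinAt
  | succ n ih =>
    rw [Nat.cast_add, Nat.cast_one, contDiffOn_succ_iff_hasFDerivWithinAt_of_uniqueDiffOn hs]
    -- Bootstrapping: the derivative `A x (u x)` is as smooth as `u`, so `u` gains one order.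
    exact ⟨by simp, fun x ↦ A x (u x), (hA.of_le (by exact_mod_cast le_top)).clm_apply ih, hu⟩

theorem exists_forall_norm_sub_le_of_continuousAt {V W : Type*} [NormedAddCommGroup V]
    [NormedAddCommGroup W] {f : V → W} {x : V} (hf : ContinuousAt f x) {ε : ℝ} (hε : 0 < ε) :
    ∃ δ > 0, ∀ z, ‖z - x‖ < δ → ‖f z - f x‖ ≤ ε := by
  obtain ⟨δ, hδ0, hδ⟩ := Metric.continuousAt_iff.1 hf ε hε
  exact ⟨δ, hδ0, fun z hz ↦ by simpa [dist_eq_norm] using (hδ (by simpa [dist_eq_norm] using hz)).le⟩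

set_option synthInstance.maxHeartbeats 200000 in
/-- A function which solves a linear total differential equation along all segments is
differentiable and solves the equation. -/
theorem hasFDerivAt_of_forall_segment {A : D → E →L[ℝ] D →L[ℝ] E} {U : Set D} {x : D}
    (hU : U ∈ 𝓝 x) (hA : ContinuousAt A x) {u : D → E}
    (hu : ∀ y ∈ U, ∃ v : ℝ → E, v 0 = u x ∧ v 1 = u y ∧ ∀ t ∈ Icc (0 : ℝ) 1,
      HasDerivWithinAt v (A (x + t • (y - x)) (v t) (y - x)) (Icc 0 1) t) :
    HasFDerivAt u (A x (u x)) x := by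
  rw [hasFDerivAt_iff_isLittleO, Asymptotics.isLittleO_iff]
  intro c hc
  -- `M` bounds `A` near `x`, and `K` is the Grönwall bound for `v` once `M * ‖h‖ ≤ 1`. The choices
  -- of `ε` and `η` give `ε * K` and `M * M * K * ‖h‖` at most `c / 2` each, the two halves of the
  -- final error.
  obtain ⟨K, hK⟩ : ∃ K, K = ‖u x‖ * Real.exp 1 := ⟨_, rfl⟩
  have hK0 : 0 ≤ K := by rw [hK]; positivity
  obtain ⟨M, hM⟩ : ∃ M, M = ‖A x‖ + 1 := ⟨_, rfl⟩
  have hM0 : 0 < M := by rw [hM]; positivity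
  obtain ⟨ε, hε⟩ : ∃ ε, ε = min 1 (c / (2 * (K + 1))) := ⟨_, rfl⟩
  have hε0 : 0 < ε := by rw [hε]; positivity
  have hε1 : ε * K ≤ c / 2 := by
    have h1 : ε ≤ c / (2 * (K + 1)) := hε ▸ min_le_right _ _
    have h2 : ε * K ≤ c / (2 * (K + 1)) * (K + 1) := by gcongr; linarith
    refine h2.trans (le_of_eq ?_)
    field_simp
  obtain ⟨δ, hδ0, hδ⟩ :=
    exists_forall_norm_sub_le_of_continuousAt (W := E →L[ℝ] D →L[ℝ] E) hA hε0
  obtain ⟨η, hη⟩ : ∃ η, η = min δ (min (1 / M) (c / (2 * (M * M * K + 1)))) := ⟨_, rfl⟩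
  have hη0 : 0 < η := by rw [hη]; positivity
  filter_upwards [hU, Metric.ball_mem_nhds x hη0] with y hyU hy
  obtain ⟨v, hv0, hv1, hv⟩ := hu y hyU
  obtain ⟨h, hh⟩ : ∃ h, h = y - x := ⟨_, rfl⟩
  rw [mem_ball_iff_norm, ← hh] at hy
  rw [← hh] at hv ⊢
  have hhδ : ‖h‖ < δ := hy.trans_le (hη ▸ min_le_left _ _)
  have hhM : M * ‖h‖ ≤ 1 := by
    have : ‖h‖ ≤ 1 / M := hy.le.trans (hη ▸ (min_le_right _ _).trans (min_le_left _ _))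
    rwa [le_div_iff₀ hM0, mul_comm] at this
  have hhc : M * M * K * ‖h‖ ≤ c / 2 := by
    have h1 : ‖h‖ ≤ c / (2 * (M * M * K + 1)) :=
      hy.le.trans (hη ▸ (min_le_right _ _).trans (min_le_right _ _))
    have h2 : M * M * K * ‖h‖ ≤ (M * M * K + 1) * (c / (2 * (M * M * K + 1))) := by
      gcongr; linarith
    refine h2.trans (le_of_eq ?_)
    field_simp
  have hAε : ∀ t ∈ Icc (0 : ℝ) 1, ‖A (x + t • h) - A x‖ ≤ ε := fun t ht ↦ by
    refine hδ _ ?_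
    rw [add_sub_cancel_left, norm_smul, Real.norm_of_nonneg ht.1]
    exact (mul_le_of_le_one_left (norm_nonneg _) ht.2).trans_lt hhδ
  have hAM : ∀ t ∈ Icc (0 : ℝ) 1, ‖A (x + t • h)‖ ≤ M := fun t ht ↦ by
    have := norm_le_norm_add_norm_sub' (E := E →L[ℝ] D →L[ℝ] E) (A (x + t • h)) (A x)
    have h1 : ε ≤ 1 := hε ▸ min_le_left _ _
    linarith [hAε t ht]
  have hvK : ∀ t ∈ Icc (0 : ℝ) 1, ‖v t‖ ≤ K := fun t ht ↦ by
    rw [hK, ← hv0]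
    refine norm_le_exp_of_hasDerivWithinAt_linear
      (B := fun t ↦ (ContinuousLinearMap.apply ℝ E h).comp (A (x + t • h))) (fun t ht ↦ ?_) hv t ht
    refine ContinuousLinearMap.opNorm_le_bound _ zero_le_one fun w ↦ ?_
    calc ‖A (x + t • h) w h‖ ≤ ‖A (x + t • h)‖ * ‖w‖ * ‖h‖ := ContinuousLinearMap.le_opNorm₂ _ _ _
      _ ≤ M * ‖w‖ * ‖h‖ := by gcongr; exact hAM t ht
      _ = (M * ‖h‖) * ‖w‖ := by ring
      _ ≤ 1 * ‖w‖ := by gcongr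
  have hvsub : ∀ t ∈ Icc (0 : ℝ) 1, ‖v t - v 0‖ ≤ M * K * ‖h‖ := fun t ht ↦ by
    have := norm_image_sub_le_of_norm_deriv_le_segment' (f := v) (C := M * K * ‖h‖) (fun t ht ↦ hv t ht)
      (fun t ht ↦ by
        have ht' := Ico_subset_Icc_self ht
        calc ‖A (x + t • h) (v t) h‖ ≤ ‖A (x + t • h)‖ * ‖v t‖ * ‖h‖ :=
              ContinuousLinearMap.le_opNorm₂ _ _ _
          _ ≤ M * K * ‖h‖ := by gcongr; exacts [hAM t ht', hvK t ht']) t ht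
    refine this.trans (mul_le_of_le_one_right (by positivity) (by simpa using ht.2))
  -- The mean value inequality for `v` minus its expected linear part. The derivative splits into
  -- the variation of `A` along the segment and the variation of `v`.
  have key := norm_image_sub_le_of_norm_deriv_le_segment_01' (f := fun t ↦ v t - t • A x (u x) h)
    (f' := fun t ↦ A (x + t • h) (v t) h - A x (u x) h) (C := c * ‖h‖)
    (fun t ht ↦ (hv t ht).sub (by simpa using (hasDerivWithinAt_id t _).smul_const (A x (u x) h)))
    (fun t ht ↦ by
      have ht' := Ico_subset_Icc_self ht
      have : A (x + t • h) (v t) h - A x (u x) h =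
          (A (x + t • h) - A x) (v t) h + A x (v t - v 0) h := by
        simp [hv0]
      rw [this]
      calc _ ≤ ‖(A (x + t • h) - A x) (v t) h‖ + ‖A x (v t - v 0) h‖ := norm_add_le _ _
        _ ≤ ‖A (x + t • h) - A x‖ * ‖v t‖ * ‖h‖ + ‖A x‖ * ‖v t - v 0‖ * ‖h‖ :=
          add_le_add (ContinuousLinearMap.le_opNorm₂ _ _ _) (ContinuousLinearMap.le_opNorm₂ _ _ _)
        _ ≤ ε * K * ‖h‖ + M * (M * K * ‖h‖) * ‖h‖ := by
          gcongr
          exacts [hAε t ht', hvK t ht', by rw [hM]; linarith, hvsub t ht']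
        _ = (ε * K + M * M * K * ‖h‖) * ‖h‖ := by ring
        _ ≤ c * ‖h‖ := by gcongr; linarith)
  simpa [hv0, hv1, sub_right_comm] using key

end TotalDifferentialEquation

/-! ### Derivatives, trivializations and the connection form. -/

section Calculus

variable {F : Type*} [NormedAddCommGroup F] [NormedSpace ℝ F]
  {M : Type*} [TopologicalSpace M] [ChartedSpace F M]
  {V W : Type*} [NormedAddCommGroup V] [NormedSpace ℝ V] [NormedAddCommGroup W] [NormedSpace ℝ W]

theorem mvfderivWithin_congr_of_eventuallyEq {u v : M → V} {s : Set M} {p : M}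
    (h : u =ᶠ[𝓝[s] p] v) (hp : u p = v p) (w : TangentSpace 𝓘(ℝ, F) p) :
    mvfderivWithin 𝓘(ℝ, F) u s p w = mvfderivWithin 𝓘(ℝ, F) v s p w :=
  DFunLike.congr_fun (h.mfderivWithin_eq (I := 𝓘(ℝ, F)) (I' := 𝓘(ℝ, V)) hp) w

theorem mvfderiv_congr_of_eventuallyEq {u v : M → V} {p : M} (h : u =ᶠ[𝓝 p] v) :
    mvfderiv 𝓘(ℝ, F) u p = mvfderiv 𝓘(ℝ, F) v p := by
  ext w
  simp only [← mvfderivWithin_univ]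
  exact mvfderivWithin_congr_of_eventuallyEq (by rwa [nhdsWithin_univ]) h.self_of_nhds w

/-- The product rule in a chart. A second application, with `u` frozen at `u p`, identifies the term
in which `G` is differentiated. -/
theorem mvfderivWithin_clm_apply {G : M → V →L[ℝ] W} {u : M → V} {s : Set M} {p : M}
    (hG : MDifferentiableWithinAt 𝓘(ℝ, F) 𝓘(ℝ, V →L[ℝ] W) G s p)
    (hu : MDifferentiableWithinAt 𝓘(ℝ, F) 𝓘(ℝ, V) u s p)
    (hs : UniqueMDiffWithinAt 𝓘(ℝ, F) s p) (w : TangentSpace 𝓘(ℝ, F) p) :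
    mvfderivWithin 𝓘(ℝ, F) (fun q ↦ G q (u q)) s p w =
      mvfderivWithin 𝓘(ℝ, F) (fun q ↦ G q (u p)) s p w + G p (mvfderivWithin 𝓘(ℝ, F) u s p w) := by
  have hGc : MDifferentiableWithinAt 𝓘(ℝ, F) 𝓘(ℝ, W) (fun q ↦ G q (u p)) s p :=
    hG.clm_apply mdifferentiableWithinAt_const
  rw [(hG.clm_apply hu).mvfderivWithin, hGc.mvfderivWithin, hu.mvfderivWithin]
  have hs' : UniqueDiffWithinAt ℝ ((extChartAt 𝓘(ℝ, F) p).symm ⁻¹' s ∩ range 𝓘(ℝ, F))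
      (extChartAt 𝓘(ℝ, F) p p) := hs
  have hl : (extChartAt 𝓘(ℝ, F) p).symm (extChartAt 𝓘(ℝ, F) p p) = p := extChartAt_to_inv p
  have hGd : DifferentiableWithinAt ℝ (fun y ↦ G ((extChartAt 𝓘(ℝ, F) p).symm y))
    ((extChartAt 𝓘(ℝ, F) p).symm ⁻¹' s ∩ range 𝓘(ℝ, F)) (extChartAt 𝓘(ℝ, F) p p) := hG.2
  have hud : DifferentiableWithinAt ℝ (fun y ↦ u ((extChartAt 𝓘(ℝ, F) p).symm y))
    ((extChartAt 𝓘(ℝ, F) p).symm ⁻¹' s ∩ range 𝓘(ℝ, F)) (extChartAt 𝓘(ℝ, F) p p) := hu.2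
  have h1 := fderivWithin_clm_apply hs' hGd hud
  have h2 := fderivWithin_clm_apply hs' hGd (differentiableWithinAt_const (u p))
  rw [hl] at h1
  rw [fderivWithin_fun_const, Pi.zero_apply, ContinuousLinearMap.comp_zero, zero_add] at h2
  rw [← h2, add_comm] at h1
  exact DFunLike.congr_fun h1 w

end Calculus

section Trivialization

variable {E : Type*} [NormedAddCommGroup E] [NormedSpace ℝ E]
  {N : Type*} [TopologicalSpace N] [ChartedSpace E N] [IsManifold 𝓘(ℝ, E) ∞ N]
  (e : Trivialization E (TotalSpace.proj : TangentBundle 𝓘(ℝ, E) N → N))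
  [MemTrivializationAtlas e]

theorem contMDiffAt_symm_const (a : E) {y : N} (hy : y ∈ e.baseSet) :
    ContMDiffAt 𝓘(ℝ, E) (𝓘(ℝ, E).prod 𝓘(ℝ, E)) ∞
      (fun z ↦ (⟨z, e.symm z a⟩ : TangentBundle 𝓘(ℝ, E) N)) y := by
  rw [e.contMDiffAt_section_iff hy]
  refine (contMDiffAt_const (c := a)).congr_of_eventuallyEq ?_
  filter_upwards [e.open_baseSet.mem_nhds hy] with z hz
  simp [hz]

/-- The flat covariant derivative defined by a trivialization. -/
theorem isCovariantDerivativeOn_flat :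
    IsCovariantDerivativeOn (I := 𝓘(ℝ, E)) E (V := fun y : N ↦ TangentSpace 𝓘(ℝ, E) y)
      (fun σ y ↦ (e.symmL ℝ y).comp
        (mvfderiv 𝓘(ℝ, E) (fun z ↦ (e (⟨z, σ z⟩ : TangentBundle 𝓘(ℝ, E) N)).2) y)) e.baseSet where
  add {σ σ' y} hσ hσ' hy := by
    rw [e.mdifferentiableAt_section_iff _ _ hy] at hσ hσ'
    rw [← ContinuousLinearMap.comp_add, ← mvfderiv_add hσ hσ']
    congr 1
    refine mvfderiv_congr_of_eventuallyEq ?_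
    filter_upwards [e.open_baseSet.mem_nhds hy] with z hz
    exact (e.linear ℝ hz).map_add _ _
  leibniz {σ g y} hσ hg hy := by
    rw [e.mdifferentiableAt_section_iff _ _ hy] at hσ
    have h : mvfderiv 𝓘(ℝ, E) (fun z ↦ (e (⟨z, (g • σ) z⟩ : TangentBundle 𝓘(ℝ, E) N)).2) y =
        mvfderiv 𝓘(ℝ, E) (g • fun z ↦ (e (⟨z, σ z⟩ : TangentBundle 𝓘(ℝ, E) N)).2) y := by
      refine mvfderiv_congr_of_eventuallyEq ?_
      filter_upwards [e.open_baseSet.mem_nhds hy] with z hz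
      exact (e.linear ℝ hz).map_smul _ _
    rw [h, mvfderiv_smul hg hσ]
    ext w
    have h1 : e.symm y ((mvfderiv 𝓘(ℝ, E) g y w) • (e ⟨y, σ y⟩).2) =
        (mvfderiv 𝓘(ℝ, E) g y w) • σ y := by
      rw [← e.symmL_apply (R := ℝ) hy, map_smul, e.symmL_apply (R := ℝ) hy,
        e.symm_apply_apply_mk hy]
    simpa [e.symmL_apply (R := ℝ) hy] using h1

/-- Sections that are constant in the trivialization have zero flat derivative, so only the
connection form survives. -/
theorem nabla_symm_const
    (nabla : CovariantDerivative 𝓘(ℝ, E) E (fun y : N ↦ TangentSpace 𝓘(ℝ, E) y))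
    {e : Trivialization E (TotalSpace.proj : TangentBundle 𝓘(ℝ, E) N → N)}
    [MemTrivializationAtlas e]
    {Γ : ∀ y : N, TangentSpace 𝓘(ℝ, E) y →L[ℝ] TangentSpace 𝓘(ℝ, E) y →L[ℝ] TangentSpace 𝓘(ℝ, E) y}
    (hΓ : ∀ y ∈ e.baseSet, ∀ σ : ∀ y : N, TangentSpace 𝓘(ℝ, E) y,
      MDifferentiableAt 𝓘(ℝ, E) (𝓘(ℝ, E).prod 𝓘(ℝ, E))
        (fun z ↦ (⟨z, σ z⟩ : TangentBundle 𝓘(ℝ, E) N)) y → ∀ w,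
      nabla σ y w = e.symm y
        (mvfderiv 𝓘(ℝ, E) (fun z ↦ (e (⟨z, σ z⟩ : TangentBundle 𝓘(ℝ, E) N)).2) y w) +
          Γ y (σ y) w) {y : N} (hy : y ∈ e.baseSet) (a : E) (w : TangentSpace 𝓘(ℝ, E) y) :
    nabla (fun z ↦ e.symm z a) y w = Γ y (e.symm y a) w := by
  rw [hΓ y hy _ ((contMDiffAt_symm_const e a hy).mdifferentiableAt (by simp))]
  have : mvfderiv 𝓘(ℝ, E) (fun z ↦ (e (⟨z, e.symm z a⟩ : TangentBundle 𝓘(ℝ, E) N)).2) y w = 0 := by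
    rw [mvfderiv_congr_of_eventuallyEq (v := fun _ ↦ a), mvfderiv_const]
    · rfl
    · filter_upwards [e.open_baseSet.mem_nhds hy] with z hz
      simp [hz]
  rw [this, ← e.symmL_apply (R := ℝ) hy, map_zero, zero_add]

end Trivialization

variable {E : Type*} [NormedAddCommGroup E] [NormedSpace ℝ E] [FiniteDimensional ℝ E]
  {N : Type*} [TopologicalSpace N] [ChartedSpace E N] [IsManifold 𝓘(ℝ, E) ∞ N]
  (nabla : CovariantDerivative 𝓘(ℝ, E) E (fun y : N ↦ TangentSpace 𝓘(ℝ, E) y))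

/-- The connection form of `nabla` in a trivialization. -/
theorem exists_connectionForm
    (e : Trivialization E (TotalSpace.proj : TangentBundle 𝓘(ℝ, E) N → N))
    [MemTrivializationAtlas e] :
    ∃ Γ : ∀ y : N, TangentSpace 𝓘(ℝ, E) y →L[ℝ] TangentSpace 𝓘(ℝ, E) y →L[ℝ] TangentSpace 𝓘(ℝ, E) y,
      ∀ y ∈ e.baseSet, ∀ σ : ∀ y : N, TangentSpace 𝓘(ℝ, E) y,
      MDifferentiableAt 𝓘(ℝ, E) (𝓘(ℝ, E).prod 𝓘(ℝ, E))
        (fun z ↦ (⟨z, σ z⟩ : TangentBundle 𝓘(ℝ, E) N)) y → ∀ w,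
      nabla σ y w = e.symm y
        (mvfderiv 𝓘(ℝ, E) (fun z ↦ (e (⟨z, σ z⟩ : TangentBundle 𝓘(ℝ, E) N)).2) y w) +
          Γ y (σ y) w := by
  -- The difference of two covariant derivatives is tensorial; here the second one is the flat
  -- derivative of `e`.
  refine ⟨IsCovariantDerivativeOn.difference
    (nabla.isCovariantDerivativeOn (s := e.baseSet)) (isCovariantDerivativeOn_flat e),
    fun y hy σ hσ w ↦ ?_⟩
  rw [IsCovariantDerivativeOn.difference_apply _ _ hy hσ]
  simp [e.symmL_apply (R := ℝ) hy]

section Along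

variable {F : Type*} [NormedAddCommGroup F] [NormedSpace ℝ F]
  {M : Type*} [TopologicalSpace M] [ChartedSpace F M]

/-- The formula defining `covDerivWithin` holds in every trivialization. -/
theorem covDerivWithin_eq (e : Trivialization E (TotalSpace.proj : TangentBundle 𝓘(ℝ, E) N → N))
    [MemTrivializationAtlas e] {Y : M → TangentBundle 𝓘(ℝ, E) N} {s : Set M} {p : M}
    (hY : MDifferentiableWithinAt 𝓘(ℝ, F) (𝓘(ℝ, E).prod 𝓘(ℝ, E)) Y s p)
    (hs : UniqueMDiffWithinAt 𝓘(ℝ, F) s p) (hp : (Y p).proj ∈ e.baseSet)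
    (w : TangentSpace 𝓘(ℝ, F) p) :
    covDerivWithin nabla Y s p w =
      e.symm (Y p).proj (mvfderivWithin 𝓘(ℝ, F) (fun q ↦ (e (Y q)).2) s p w) +
        nabla (fun z ↦ e.symm z (e (Y p)).2) (Y p).proj
          (mfderivWithin 𝓘(ℝ, F) 𝓘(ℝ, E) (fun q ↦ (Y q).proj) s p w) := by
  set e' := trivializationAt E (TangentSpace 𝓘(ℝ, E)) (Y p).proj with he'
  have hp' : (Y p).proj ∈ e'.baseSet := FiberBundle.mem_baseSet_trivializationAt' _
  obtain ⟨Γ, hΓ⟩ := exists_connectionForm nabla e'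
  obtain ⟨hYp, hYe⟩ := (e.mdifferentiableWithinAt_totalSpace_iff _ Y (e.mem_source.2 hp)).1 hY
  have hmem : (Y p).proj ∈ e.baseSet ∩ e'.baseSet := ⟨hp, hp'⟩
  have hopen := (e.open_baseSet.inter e'.open_baseSet).mem_nhds hmem
  -- `G` is the transition from `e` to `e'`. The product rule for `G` applied to the `e`-coordinates
  -- yields an extra term differentiating `G`; `h2` shows that `nabla` of the `e`-constant section
  -- contains exactly this term.
  obtain ⟨G, hG, hGa⟩ : ∃ G : N → E →L[ℝ] E,
      MDifferentiableAt 𝓘(ℝ, E) 𝓘(ℝ, E →L[ℝ] E) G (Y p).proj ∧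
        ∀ z ∈ e.baseSet ∩ e'.baseSet, ∀ a, G z a = (e' ⟨z, e.symm z a⟩).2 :=
    ⟨fun z ↦ e.coordChangeL ℝ e' z, mdifferentiableAt_coordChangeL hp hp',
      fun z hz a ↦ e.coordChangeL_apply e' hz a⟩
  have hext : FiberBundle.extend E (Y p).2 = fun z ↦ e'.symm z (e' (Y p)).2 := rfl
  have hGu := mvfderivWithin_clm_apply (hG.comp_mdifferentiableWithinAt p hYp) hYe hs w
  have h1 : mvfderivWithin 𝓘(ℝ, F) (fun q ↦ (e' (Y q)).2) s p w =
      mvfderivWithin 𝓘(ℝ, F) (fun q ↦ (G ∘ fun q ↦ (Y q).proj) q (e (Y q)).2) s p w := by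
    refine mvfderivWithin_congr_of_eventuallyEq ?_ ?_ w
    · filter_upwards [hYp.continuousWithinAt hopen] with q hq
      rw [Function.comp_apply, hGa _ hq, e.symm_proj_apply _ hq.1]
    · rw [Function.comp_apply, hGa _ hmem, e.symm_proj_apply _ hp]
  have h2 : mvfderiv 𝓘(ℝ, E) (fun z ↦ (e' ⟨z, e.symm z (e (Y p)).2⟩).2) (Y p).proj
        (mfderivWithin 𝓘(ℝ, F) 𝓘(ℝ, E) (fun q ↦ (Y q).proj) s p w) =
      mvfderivWithin 𝓘(ℝ, F) (fun q ↦ (G ∘ fun q ↦ (Y q).proj) q (e (Y p)).2) s p w := by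
    rw [mvfderiv_congr_of_eventuallyEq (v := fun z ↦ G z (e (Y p)).2)]
    · exact (DFunLike.congr_fun (mfderiv_comp_mfderivWithin (I := 𝓘(ℝ, F)) (I'' := 𝓘(ℝ, E))
        (I' := 𝓘(ℝ, E)) p (hG.clm_apply mdifferentiableAt_const) hYp hs) w).symm
    · filter_upwards [hopen] with q hq
      rw [hGa _ hq]
  rw [covDerivWithin, hext, nabla_symm_const nabla hΓ hp',
    hΓ _ hp' _ ((contMDiffAt_symm_const e _ hp).mdifferentiableAt (by simp)), ← he', h1, h2, hGu,
    e.symm_proj_apply _ hp, e'.symm_proj_apply _ hp', ← e'.symmL_apply (R := ℝ) hp', map_add,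
    Function.comp_apply, hGa _ hmem, e'.symmL_apply (R := ℝ) hp', e'.symmL_apply (R := ℝ) hp',
    e'.symm_apply_apply_mk hp',
    ← add_assoc, add_comm (e.symm _ _)]

end Along

section Smoothness

variable {E : Type*} [NormedAddCommGroup E] [NormedSpace ℝ E] [FiniteDimensional ℝ E]
  {N : Type*} [TopologicalSpace N] [ChartedSpace E N] [IsManifold 𝓘(ℝ, E) ∞ N]
  {nabla : CovariantDerivative 𝓘(ℝ, E) E (fun y : N ↦ TangentSpace 𝓘(ℝ, E) y)}
  (e : Trivialization E (TotalSpace.proj : TangentBundle 𝓘(ℝ, E) N → N))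
  [MemTrivializationAtlas e]

/-- The smoothness of `nabla` is applied to a globally smooth section: the frame section cut off by
a bump function equal to one near `y₀`. Since `nabla` is local, nothing changes on `U`, which does
not depend on `a`. -/
theorem exists_contMDiffOn_nabla_symm_const [T2Space N]
    (hnabla : nabla.ContMDiffCovariantDerivative ∞) {y₀ : N} (hy₀ : y₀ ∈ e.baseSet) :
    ∃ U : Set N, IsOpen U ∧ y₀ ∈ U ∧ U ⊆ e.baseSet ∧ ∀ a : E,
      ContMDiffOn 𝓘(ℝ, E) (𝓘(ℝ, E).prod 𝓘(ℝ, E →L[ℝ] E)) ∞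
        (fun y ↦ TotalSpace.mk' (E →L[ℝ] E)
          (E := fun y : N ↦ TangentSpace 𝓘(ℝ, E) y →L[ℝ] TangentSpace 𝓘(ℝ, E) y) y
          (nabla (fun z ↦ e.symm z a) y)) U := by
  obtain ⟨χ, -, hχ⟩ := (SmoothBumpFunction.nhds_basis_tsupport (I := 𝓘(ℝ, E)) y₀).mem_iff.1
    (e.open_baseSet.mem_nhds hy₀)
  obtain ⟨U', hU'χ, hU', hyU'⟩ := eventually_nhds_iff.1 χ.eventuallyEq_one
  refine ⟨U' ∩ e.baseSet, hU'.inter e.open_baseSet, ⟨hyU', hy₀⟩, inter_subset_right, fun a ↦ ?_⟩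
  have hσ : ContMDiff 𝓘(ℝ, E) (𝓘(ℝ, E).prod 𝓘(ℝ, E)) ∞
      (fun z ↦ TotalSpace.mk' E (E := fun y : N ↦ TangentSpace 𝓘(ℝ, E) y) z
        (χ z • e.symm z a)) := fun z ↦ by
    by_cases hz : z ∈ e.baseSet
    · exact χ.contMDiffAt.smul_section (contMDiffAt_symm_const e a hz)
    · have hz' : z ∉ tsupport χ := fun h ↦ hz (hχ h)
      refine (contMDiffAt_zeroSection ℝ _).congr_of_eventuallyEq ?_
      filter_upwards [(isClosed_tsupport χ).isOpen_compl.mem_nhds hz'] with x hx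
      simp [image_eq_zero_of_notMem_tsupport hx, zeroSection]
  have h := hnabla.contMDiff.contMDiff (σ := fun z ↦ χ z • e.symm z a) hσ.contMDiffOn
  refine (h.mono (subset_univ _)).congr fun y hy ↦ ?_
  congr 1
  refine nabla.isCovariantDerivativeOnUniv.congr_of_eventuallyEq
    ((contMDiffAt_symm_const e a hy.2).mdifferentiableAt (by simp))
    ((hσ y).mdifferentiableAt (by simp)) Filter.univ_mem ?_
  filter_upwards [hU'.mem_nhds hy.1] with z hz
  simp [hU'χ z hz]

variable {D : Type*} [NormedAddCommGroup D] [NormedSpace ℝ D] [FiniteDimensional ℝ D]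

/-- The connection form pulled back to a subset of a vector space. -/
theorem exists_contDiffOn_connectionForm {U : Set N} (hUe : U ⊆ e.baseSet)
    (hU : ∀ a : E, ContMDiffOn 𝓘(ℝ, E) (𝓘(ℝ, E).prod 𝓘(ℝ, E →L[ℝ] E)) ∞
        (fun y ↦ TotalSpace.mk' (E →L[ℝ] E)
          (E := fun y : N ↦ TangentSpace 𝓘(ℝ, E) y →L[ℝ] TangentSpace 𝓘(ℝ, E) y) y
          (nabla (fun z ↦ e.symm z a) y)) U) {g : D → N} {s : Set D} (hs : UniqueDiffOn ℝ s)
    (hg : ContMDiffOn 𝓘(ℝ, D) 𝓘(ℝ, E) ∞ g s) (hgU : MapsTo g s U) :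
    ∃ A : D → E →L[ℝ] D →L[ℝ] E, ContDiffOn ℝ ∞ A s ∧ ∀ x ∈ s, ∀ a (w : D),
      A x a w = (e ⟨g x, nabla (fun z ↦ e.symm z a) (g x)
        (mfderivWithin 𝓘(ℝ, D) 𝓘(ℝ, E) g s x w)⟩).2 := by
  obtain ⟨Γ, hΓ⟩ := exists_connectionForm nabla e
  obtain ⟨d, hd⟩ : ∃ d : ∀ x, D →L[ℝ] TangentSpace 𝓘(ℝ, E) (g x), ∀ x (w : D),
      d x w = mfderivWithin 𝓘(ℝ, D) 𝓘(ℝ, E) g s x w :=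
    ⟨fun x ↦ mfderivWithin 𝓘(ℝ, D) 𝓘(ℝ, E) g s x, fun _ _ ↦ rfl⟩
  let A : D → E →L[ℝ] D →L[ℝ] E := fun x ↦ LinearMap.toContinuousLinearMap
    { toFun a := (e.continuousLinearMapAt ℝ (g x)).comp ((Γ (g x) (e.symmL ℝ (g x) a)).comp (d x))
      map_add' a b := by
        rw [map_add, map_add, ContinuousLinearMap.add_comp, ContinuousLinearMap.comp_add]
      map_smul' c a := by
        rw [map_smul, map_smul, ContinuousLinearMap.smul_comp, ContinuousLinearMap.comp_smul, RingHom.id_apply] }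
  have hA : ∀ x ∈ s, ∀ a (w : D), A x a w = (e ⟨g x, nabla (fun z ↦ e.symm z a) (g x)
        (mfderivWithin 𝓘(ℝ, D) 𝓘(ℝ, E) g s x w)⟩).2 := fun x hx a w ↦ by
    have hx' := hUe (hgU hx)
    rw [nabla_symm_const nabla hΓ hx', ← e.continuousLinearMapAt_apply_of_mem (R := ℝ) hx',
      ← e.symmL_apply (R := ℝ) hx', ← hd]
    rfl
  -- In finite dimension, smoothness of an operator-valued map can be tested on fixed vectors `a`
  -- and `w`.
  refine ⟨A, contDiffOn_clm_apply.2 fun a ↦ contDiffOn_clm_apply.2 fun w ↦ ?_, hA⟩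
  refine ContDiffOn.congr ?_ fun x hx ↦ hA x hx a w
  rw [← contMDiffOn_iff_contDiffOn]
  have hv : ContMDiffOn 𝓘(ℝ, D) (𝓘(ℝ, E).prod 𝓘(ℝ, E)) ∞
      (fun x ↦ TotalSpace.mk' E (E := fun y : N ↦ TangentSpace 𝓘(ℝ, E) y) (g x)
        (mfderivWithin 𝓘(ℝ, D) 𝓘(ℝ, E) g s x w)) s := by
    have hT := hg.contMDiffOn_tangentMapWithin (m := ∞) (by simp) hs.uniqueMDiffOn
    have hw : ContMDiff 𝓘(ℝ, D) (𝓘(ℝ, D).prod 𝓘(ℝ, D)) ∞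
        (fun x ↦ (⟨x, w⟩ : TangentBundle 𝓘(ℝ, D) D)) :=
      contMDiff_vectorSpace_iff_contDiff.2 (contDiff_const (c := w))
    exact hT.comp hw.contMDiffOn fun x hx ↦ hx
  have hc := ((hU a).comp hg hgU).clm_bundle_apply (b := g)
    (ϕ := fun x ↦ nabla (fun z ↦ e.symm z a) (g x)) hv
  exact ((e.contMDiffOn_iff fun x hx ↦ e.mem_source.2 (hUe (hgU hx))).1 hc).2

end Smoothness

section Coordinates

variable {E : Type*} [NormedAddCommGroup E] [NormedSpace ℝ E] [FiniteDimensional ℝ E]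
  {N : Type*} [TopologicalSpace N] [ChartedSpace E N] [IsManifold 𝓘(ℝ, E) ∞ N]
  {nabla : CovariantDerivative 𝓘(ℝ, E) E (fun y : N ↦ TangentSpace 𝓘(ℝ, E) y)}
  {F : Type*} [NormedAddCommGroup F] [NormedSpace ℝ F]
  {M : Type*} [TopologicalSpace M] [ChartedSpace F M]
  {e : Trivialization E (TotalSpace.proj : TangentBundle 𝓘(ℝ, E) N → N)}
  [MemTrivializationAtlas e]

/-- The equation `∇_w Y = 0` in a trivialization. -/
theorem covDerivWithin_eq_zero_iff {Y : M → TangentBundle 𝓘(ℝ, E) N} {s : Set M} {p : M}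
    (hY : MDifferentiableWithinAt 𝓘(ℝ, F) (𝓘(ℝ, E).prod 𝓘(ℝ, E)) Y s p)
    (hs : UniqueMDiffWithinAt 𝓘(ℝ, F) s p) (hp : (Y p).proj ∈ e.baseSet)
    (w : TangentSpace 𝓘(ℝ, F) p) :
    covDerivWithin nabla Y s p w = 0 ↔
      mvfderivWithin 𝓘(ℝ, F) (fun q ↦ (e (Y q)).2) s p w =
        -(e ⟨(Y p).proj, nabla (fun z ↦ e.symm z (e (Y p)).2) (Y p).proj
          (mfderivWithin 𝓘(ℝ, F) 𝓘(ℝ, E) (fun q ↦ (Y q).proj) s p w)⟩).2 := by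
  rw [covDerivWithin_eq nabla e hY hs hp, ← e.symmL_apply (R := ℝ) hp,
    ← (e.continuousLinearEquivAt ℝ _ hp).map_eq_zero_iff, map_add,
    eq_neg_iff_add_eq_zero]
  have h1 (a : E) : e.continuousLinearEquivAt ℝ (Y p).proj hp (e.symmL ℝ (Y p).proj a) = a := by
    rw [← e.symm_continuousLinearEquivAt_eq hp]
    exact ContinuousLinearEquiv.apply_symm_apply _ _
  rw [h1]
  rfl

/-- The parallel transport equation along a curve in a trivialization. -/
theorem covDerivWithin_one_eq_zero_iff {V : ℝ → TangentBundle 𝓘(ℝ, E) N} {s : Set ℝ} {t : ℝ}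
    (hV : MDifferentiableWithinAt 𝓘(ℝ, ℝ) (𝓘(ℝ, E).prod 𝓘(ℝ, E)) V s t)
    (hs : UniqueDiffWithinAt ℝ s t) (ht : (V t).proj ∈ e.baseSet) :
    covDerivWithin (F := ℝ) nabla V s t (1 : ℝ) = 0 ↔
      HasDerivWithinAt (fun t ↦ (e (V t)).2)
        (-(e ⟨(V t).proj, nabla (fun z ↦ e.symm z (e (V t)).2) (V t).proj
          (mfderivWithin 𝓘(ℝ, ℝ) 𝓘(ℝ, E) (fun q ↦ (V q).proj) s t (1 : ℝ))⟩).2) s t := by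
  obtain ⟨hVp, hVe⟩ := (e.mdifferentiableWithinAt_totalSpace_iff _ V (e.mem_source.2 ht)).1 hV
  have hd : DifferentiableWithinAt ℝ (fun t ↦ (e (V t)).2) s t :=
    mdifferentiableWithinAt_iff_differentiableWithinAt.1 hVe
  have h1 : mvfderivWithin 𝓘(ℝ, ℝ) (fun t ↦ (e (V t)).2) s t (1 : ℝ) =
      derivWithin (fun t ↦ (e (V t)).2) s t := by
    rw [← fderivWithin_derivWithin, ← mfderivWithin_eq_fderivWithin]
    rfl
  refine (covDerivWithin_eq_zero_iff hV hs.uniqueMDiffWithinAt ht (1 : ℝ)).trans ?_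
  rw [h1]
  exact ⟨fun h ↦ h ▸ hd.hasDerivWithinAt, fun h ↦ h.derivWithin hs⟩

end Coordinates

theorem onPieces_of_Icc {P : Set ℝ → Prop} (h : P (Icc 0 1)) : OnPieces P := by
  refine ⟨1, ![0, 1], ?_, rfl, rfl, fun i ↦ ?_⟩
  · rw [Fin.strictMono_iff_lt_succ]
    simp
  · fin_cases i
    simpa using h

/-! ### Parallel transport along segments in small chart balls. -/

section Transport

variable {E : Type*} [NormedAddCommGroup E] [NormedSpace ℝ E] [FiniteDimensional ℝ E]
  {N : Type*} [TopologicalSpace N] [ChartedSpace E N] [IsManifold 𝓘(ℝ, E) ∞ N]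
  (nabla : CovariantDerivative 𝓘(ℝ, E) E (fun y : N ↦ TangentSpace 𝓘(ℝ, E) y))
  {F : Type*} [NormedAddCommGroup F] [NormedSpace ℝ F]
  {M : Type*} [TopologicalSpace M] [ChartedSpace F M] (f : M → N)

variable (F) in
/-- `P` is the parallel transport along some piecewise smooth path from `x` to `y`. -/
def IsPathTransport {x y : M}
    (P : TangentSpace 𝓘(ℝ, E) (f x) ≃ₗ[ℝ] TangentSpace 𝓘(ℝ, E) (f y)) : Prop :=
  ∃ γ : Path x y, IsPiecewiseSmooth (F := F) γ ∧ IsParallelTransport nabla f γ P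

/-- A ball in a chart of `M` in which the parallel fields are the solutions of the linear total
differential equation with coefficients `A`, which are small. -/
structure IsTransportBall (p₀ : M) (r : ℝ) (A : F → E →L[ℝ] F →L[ℝ] E) : Prop where
  pos : 0 < r
  subset_target : Metric.ball (extChartAt 𝓘(ℝ, F) p₀ p₀) r ⊆ (extChartAt 𝓘(ℝ, F) p₀).target
  mem_baseSet : ∀ y ∈ Metric.ball (extChartAt 𝓘(ℝ, F) p₀ p₀) r,
    f ((extChartAt 𝓘(ℝ, F) p₀).symm y) ∈
      (trivializationAt E (TangentSpace 𝓘(ℝ, E)) (f p₀)).baseSet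
  contDiffOn : ContDiffOn ℝ ∞ A (Metric.ball (extChartAt 𝓘(ℝ, F) p₀ p₀) r)
  apply_eq : ∀ y ∈ Metric.ball (extChartAt 𝓘(ℝ, F) p₀ p₀) r, ∀ a (w : F), A y a w =
    -(trivializationAt E (TangentSpace 𝓘(ℝ, E)) (f p₀)
      ⟨f ((extChartAt 𝓘(ℝ, F) p₀).symm y),
        nabla (fun z ↦ (trivializationAt E (TangentSpace 𝓘(ℝ, E)) (f p₀)).symm z a)
        (f ((extChartAt 𝓘(ℝ, F) p₀).symm y))
        (mfderiv 𝓘(ℝ, F) 𝓘(ℝ, E) (f ∘ (extChartAt 𝓘(ℝ, F) p₀).symm) y w)⟩).2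
  norm_mul_le : ∀ y ∈ Metric.ball (extChartAt 𝓘(ℝ, F) p₀ p₀) r,
    ∀ y₁ ∈ Metric.ball (extChartAt 𝓘(ℝ, F) p₀ p₀) r,
    ∀ y₂ ∈ Metric.ball (extChartAt 𝓘(ℝ, F) p₀ p₀) r, ‖A y‖ * ‖y₂ - y₁‖ ≤ 1 / 2

variable [FiniteDimensional ℝ F] [IsManifold 𝓘(ℝ, F) ∞ M]

set_option synthInstance.maxHeartbeats 200000 in
theorem exists_isTransportBall [T2Space N] (hnabla : nabla.ContMDiffCovariantDerivative ∞)
    (hf : ContMDiff 𝓘(ℝ, F) 𝓘(ℝ, E) ∞ f) (p₀ : M) :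
    ∃ (r : ℝ) (A : F → E →L[ℝ] F →L[ℝ] E), IsTransportBall nabla f p₀ r A := by
  set φ := extChartAt 𝓘(ℝ, F) p₀ with hφ
  set e := trivializationAt E (TangentSpace 𝓘(ℝ, E)) (f p₀) with he
  obtain ⟨U, hU, hpU, hUe, hUn⟩ := exists_contMDiffOn_nabla_symm_const e hnabla
    (FiberBundle.mem_baseSet_trivializationAt' (f p₀))
  have hφt : IsOpen φ.target := isOpen_extChartAt_target p₀
  have hφ₀ : φ p₀ ∈ φ.target := mem_extChartAt_target p₀
  have hg : ContMDiffOn 𝓘(ℝ, F) 𝓘(ℝ, E) ∞ (f ∘ φ.symm) φ.target :=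
    hf.comp_contMDiffOn (contMDiffOn_extChartAt_symm p₀)
  have hO : IsOpen (φ.target ∩ (f ∘ φ.symm) ⁻¹' U) := hg.continuousOn.isOpen_inter_preimage hφt hU
  obtain ⟨r₀, hr₀, hball⟩ := Metric.isOpen_iff.1 hO (φ p₀) ⟨hφ₀, by simpa [hφ] using hpU⟩
  obtain ⟨A, hA, hAg⟩ := exists_contDiffOn_connectionForm e hUe hUn
    Metric.isOpen_ball.uniqueDiffOn (hg.mono (hball.trans inter_subset_left))
    (fun y hy ↦ (hball hy).2)
  obtain ⟨δ, hδ, hAδ⟩ := exists_forall_norm_sub_le_of_continuousAt (W := E →L[ℝ] F →L[ℝ] E)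
    (hA.continuousOn.continuousAt (Metric.ball_mem_nhds _ hr₀)) one_pos
  obtain ⟨C, hC⟩ : ∃ C, C = ‖A (φ p₀)‖ + 1 := ⟨_, rfl⟩
  have hC0 : 0 < C := by rw [hC]; positivity
  -- Within `δ` the norm of `A` is at most `C`, and segments in the ball have length at most `2 * r
  -- ≤ 1 / (2 * C)`; the product is then at most `1 / 2`, as `exists_linearEquiv_flow` requires.
  obtain ⟨r, hr⟩ : ∃ r, r = min r₀ (min δ (1 / (4 * C))) := ⟨_, rfl⟩
  have hr0 : 0 < r := by rw [hr]; positivity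
  have hrr₀ : Metric.ball (φ p₀) r ⊆ Metric.ball (φ p₀) r₀ :=
    Metric.ball_subset_ball (hr ▸ min_le_left _ _)
  have hrδ : r ≤ δ := hr ▸ (min_le_right _ _).trans (min_le_left _ _)
  have hrC : r ≤ 1 / (4 * C) := hr ▸ (min_le_right _ _).trans (min_le_right _ _)
  refine ⟨r, fun y ↦ -A y, hr0, hrr₀.trans (hball.trans inter_subset_left),
    fun y hy ↦ hUe (hball (hrr₀ hy)).2, (hA.mono hrr₀).neg, fun y hy a w ↦ ?_,
    fun y hy y₁ hy₁ y₂ hy₂ ↦ ?_⟩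
  · rw [← mfderivWithin_of_isOpen Metric.isOpen_ball (hrr₀ hy)]
    exact congrArg Neg.neg (hAg y (hrr₀ hy) a w)
  · have h1 : ‖A y‖ ≤ C := by
      have := norm_le_norm_add_norm_sub' (E := E →L[ℝ] F →L[ℝ] E) (A y) (A (φ p₀))
      have := hAδ y ((mem_ball_iff_norm.1 hy).trans_le hrδ)
      linarith
    have h2 : ‖y₂ - y₁‖ ≤ 2 * r := by
      rw [← dist_eq_norm]
      have := dist_triangle_right y₂ y₁ (φ p₀)
      have h3 := Metric.mem_ball.1 hy₁
      have h4 := Metric.mem_ball.1 hy₂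
      linarith
    calc ‖-A y‖ * ‖y₂ - y₁‖ ≤ C * (2 * (1 / (4 * C))) := by
          rw [ContinuousLinearMap.opNorm_neg]
          gcongr
          linarith
      _ = 1 / 2 := by field_simp; norm_num

end Transport

section Segment

variable {E : Type*} [NormedAddCommGroup E] [NormedSpace ℝ E] [FiniteDimensional ℝ E]
  {N : Type*} [TopologicalSpace N] [ChartedSpace E N] [IsManifold 𝓘(ℝ, E) ∞ N]
  {nabla : CovariantDerivative 𝓘(ℝ, E) E (fun y : N ↦ TangentSpace 𝓘(ℝ, E) y)}
  {F : Type*} [NormedAddCommGroup F] [NormedSpace ℝ F]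
  {M : Type*} [TopologicalSpace M] [ChartedSpace F M] {f : M → N} [IsManifold 𝓘(ℝ, F) ∞ M]

/-- The transport is the time-one flow of the segment ODE, conjugated by the trivialization. The ODE
is kept in the conclusion because differentiability of the transported field is deduced from it. -/
theorem IsTransportBall.exists_isPathTransport (hf : ContMDiff 𝓘(ℝ, F) 𝓘(ℝ, E) ∞ f) {p₀ : M} {r : ℝ}
    {A : F → E →L[ℝ] F →L[ℝ] E} (hA : IsTransportBall nabla f p₀ r A) {y y' : F}
    (hy : y ∈ Metric.ball (extChartAt 𝓘(ℝ, F) p₀ p₀) r)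
    (hy' : y' ∈ Metric.ball (extChartAt 𝓘(ℝ, F) p₀ p₀) r) :
    ∃ P, IsPathTransport nabla F f (x := (extChartAt 𝓘(ℝ, F) p₀).symm y)
      (y := (extChartAt 𝓘(ℝ, F) p₀).symm y') P ∧
      ∀ v, ∃ u : ℝ → E, u 0 = (trivializationAt E (TangentSpace 𝓘(ℝ, E)) (f p₀)
          ⟨f ((extChartAt 𝓘(ℝ, F) p₀).symm y), v⟩).2 ∧
        u 1 = (trivializationAt E (TangentSpace 𝓘(ℝ, E)) (f p₀)
          ⟨f ((extChartAt 𝓘(ℝ, F) p₀).symm y'), P v⟩).2 ∧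
        ∀ t ∈ Icc (0 : ℝ) 1,
          HasDerivWithinAt u (A (y + t • (y' - y)) (u t) (y' - y)) (Icc 0 1) t := by
  set φ := extChartAt 𝓘(ℝ, F) p₀ with hφ
  set e := trivializationAt E (TangentSpace 𝓘(ℝ, E)) (f p₀) with he
  have hφt : IsOpen φ.target := isOpen_extChartAt_target p₀
  have hφs : ContMDiffOn 𝓘(ℝ, F) 𝓘(ℝ, F) ∞ φ.symm φ.target := contMDiffOn_extChartAt_symm p₀
  have hg : ContMDiffOn 𝓘(ℝ, F) 𝓘(ℝ, E) ∞ (f ∘ φ.symm) φ.target := hf.comp_contMDiffOn hφs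
  obtain ⟨h, hh⟩ : ∃ h, h = y' - y := ⟨_, rfl⟩
  rw [← hh]
  obtain ⟨l, hl⟩ : ∃ l : ℝ → F, l = fun t ↦ y + t • h := ⟨_, rfl⟩
  have hlt (t : ℝ) : y + t • h = l t := by rw [hl]
  simp only [hlt]
  have hl0 : l 0 = y := by simp [hl]
  have hl1 : l 1 = y' := by simp [hl, hh]
  have hlb : ∀ t ∈ Icc (0 : ℝ) 1, l t ∈ Metric.ball (φ p₀) r := fun t ht ↦ by
    rw [hl, hh]
    exact (convex_ball _ _).add_smul_sub_mem hy hy' ht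
  have hlT : MapsTo l (Icc 0 1) φ.target := fun t ht ↦ hA.subset_target (hlb t ht)
  have hls : ContDiff ℝ ∞ l := by rw [hl]; fun_prop
  have hld (t : ℝ) : HasDerivAt l h t := by
    rw [hl]
    simpa using ((hasDerivAt_id t).smul_const h).const_add y
  have hAl : ContDiffOn ℝ ∞ (fun t ↦ A (l t)) (Icc 0 1) :=
    hA.contDiffOn.comp hls.contDiffOn hlb
  obtain ⟨P₀, hP₀⟩ := exists_linearEquiv_flow
    (B := fun t ↦ (ContinuousLinearMap.apply ℝ E h).comp (A (l t)))
    (continuousOn_const.clm_comp hAl.continuousOn) (fun t ht ↦ by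
      refine ContinuousLinearMap.opNorm_le_bound _ (by norm_num) fun w ↦ ?_
      calc ‖A (l t) w h‖ ≤ ‖A (l t)‖ * ‖w‖ * ‖h‖ := ContinuousLinearMap.le_opNorm₂ _ _ _
        _ = (‖A (l t)‖ * ‖h‖) * ‖w‖ := by ring
        _ ≤ 1 / 2 * ‖w‖ := by
          gcongr
          rw [hh]
          exact hA.norm_mul_le _ (hlb t ht) _ hy _ hy')
  have hby : f (φ.symm y) ∈ e.baseSet := hA.mem_baseSet y hy
  have hby' : f (φ.symm y') ∈ e.baseSet := hA.mem_baseSet y' hy'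
  let P : TangentSpace 𝓘(ℝ, E) (f (φ.symm y)) ≃ₗ[ℝ] TangentSpace 𝓘(ℝ, E) (f (φ.symm y')) :=
    (e.continuousLinearEquivAt ℝ _ hby).toLinearEquiv.trans
      (P₀.trans (e.continuousLinearEquivAt ℝ _ hby').symm.toLinearEquiv)
  have hPe (v : TangentSpace 𝓘(ℝ, E) (f (φ.symm y))) :
      P v = e.symm (f (φ.symm y')) (P₀ (e ⟨_, v⟩).2) := rfl
  choose u hu0 hu1 hu using hP₀
  let γ : Path (φ.symm y) (φ.symm y') :=
    { toFun t := φ.symm (l t)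
      continuous_toFun := by
        refine hφs.continuousOn.comp_continuous (by fun_prop) fun t ↦ hlT t.2
      source' := by simp [hl0]
      target' := by simp [hl1] }
  have hγ : ∀ t ∈ Icc (0 : ℝ) 1, γ.extend t = φ.symm (l t) := fun t ht ↦ γ.extend_apply ht
  have hγs : IsPiecewiseSmooth (F := F) γ :=
    onPieces_of_Icc ((hφs.comp hls.contMDiff.contMDiffOn hlT).congr hγ)
  have hPu (v : TangentSpace 𝓘(ℝ, E) (f (φ.symm y))) : u (e ⟨_, v⟩).2 1 = (e ⟨_, P v⟩).2 := by
    rw [hPe, e.apply_mk_symm hby']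
    exact hu1 _
  refine ⟨P, ⟨γ, hγs, fun v ↦ ?_⟩, fun v ↦ ⟨u (e ⟨_, v⟩).2, hu0 _, hPu v, hu _⟩⟩
  · have hu' := hu (e ⟨_, v⟩).2
    have hu0' := hu0 (e ⟨_, v⟩).2
    have hu1' := hu1 (e ⟨_, v⟩).2
    generalize u (e ⟨_, v⟩).2 = u at hu' hu0' hu1'
    have hus : ContDiffOn ℝ ∞ u (Icc 0 1) := by
      refine ODE.contDiffOn_enat_Icc_of_hasDerivWithinAt (n := ⊤) (f := fun t x ↦ A (l t) x h)
        (u := univ) ?_ hu' (mapsTo_univ _ _)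
      exact ((hAl.comp contDiffOn_fst fun x hx ↦ hx.1).clm_apply contDiffOn_snd).clm_apply
        contDiffOn_const
    let V : ℝ → TangentBundle 𝓘(ℝ, E) N := fun t ↦
      ⟨f (φ.symm (l t)), e.symm (f (φ.symm (l t))) (u t)⟩
    -- A free `z` allows the base point to be replaced along `l 0 = y` and `l 1 = y'` despite the
    -- dependent fibre.
    have hV (t : ℝ) (z : F) (hz : l t = z) : V t = ⟨f (φ.symm z), e.symm (f (φ.symm z)) (u t)⟩ := by
      subst hz
      rfl
    have hVb : ∀ t ∈ Icc (0 : ℝ) 1, (V t).proj ∈ e.baseSet := fun t ht ↦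
      hA.mem_baseSet _ (hlb t ht)
    have hVe : ∀ t ∈ Icc (0 : ℝ) 1, (e (V t)).2 = u t := fun t ht ↦ by
      simp only [V]
      rw [e.apply_mk_symm (hVb t ht)]
    have hVs : ContMDiffOn 𝓘(ℝ, ℝ) (𝓘(ℝ, E).prod 𝓘(ℝ, E)) ∞ V (Icc 0 1) := by
      refine (e.contMDiffOn_iff fun t ht ↦ e.mem_source.2 (hVb t ht)).2
        ⟨hg.comp hls.contMDiff.contMDiffOn hlT, ?_⟩
      exact hus.contMDiffOn.congr hVe
    refine ⟨V, ⟨fun t ht ↦ ?_, onPieces_of_Icc ⟨hVs, fun t ht ↦ ?_⟩⟩, ?_, ?_⟩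
    · rw [hγ t ht]
    · have hun := uniqueDiffOn_Icc (zero_lt_one' ℝ) t ht
      rw [covDerivWithin_one_eq_zero_iff ((hVs t ht).mdifferentiableWithinAt (by simp)) hun
        (hVb t ht)]
      refine HasDerivWithinAt.congr_of_mem ?_ hVe ht
      convert hu' t ht using 1
      have hd : mfderivWithin 𝓘(ℝ, ℝ) 𝓘(ℝ, E) (fun q ↦ (V q).proj) (Icc 0 1) t (1 : ℝ) =
          mfderiv 𝓘(ℝ, F) 𝓘(ℝ, E) (f ∘ φ.symm) (l t) h := by
        have hgt : MDifferentiableAt 𝓘(ℝ, F) 𝓘(ℝ, E) (f ∘ φ.symm) (l t) :=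
          ((hg (l t) (hlT ht)).contMDiffAt (hφt.mem_nhds (hlT ht))).mdifferentiableAt (by simp)
        have h1 := mfderiv_comp_mfderivWithin (I := 𝓘(ℝ, ℝ)) (I' := 𝓘(ℝ, F)) (I'' := 𝓘(ℝ, E)) t hgt
          (hld t).differentiableAt.mdifferentiableAt.mdifferentiableWithinAt hun.uniqueMDiffWithinAt
        have h2 : mfderivWithin 𝓘(ℝ, ℝ) 𝓘(ℝ, F) l (Icc 0 1) t (1 : ℝ) = h := by
          have h4 : fderivWithin ℝ l (Icc 0 1) t (1 : ℝ) = h :=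
            fderivWithin_derivWithin.trans ((hld t).hasDerivWithinAt.derivWithin hun)
          exact (DFunLike.congr_fun mfderivWithin_eq_fderivWithin (1 : ℝ)).trans h4
        have h3 := DFunLike.congr_fun h1 (1 : ℝ)
        refine h3.trans ?_
        rw [← h2]
        rfl
      rw [hVe t ht, hd]
      exact (hA.apply_eq _ (hlb t ht) (u t) h).symm
    · rw [hV 0 y hl0, hu0', e.symm_apply_apply_mk hby]
    · rw [hV 1 y' hl1, hu1', hPe]

end Segment

/-! ### Subdivisions of the unit interval. -/

section Pieces

/-- Viewing a subdivision as a chain of intervals turns refinement, concatenation and induction over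
pieces into operations on `Relation.TransGen`. -/
theorem onPieces_iff_transGen {P : Set ℝ → Prop} :
    OnPieces P ↔ Relation.TransGen (fun a b ↦ a < b ∧ P (Icc a b)) 0 1 := by
  constructor
  · rintro ⟨n, t, ht, h0, h1, h⟩
    have hi (i : Fin (n + 1)) : Relation.ReflTransGen (fun a b ↦ a < b ∧ P (Icc a b)) 0 (t i) := by
      induction i using Fin.induction with
      | zero => rw [h0]
      | succ i ih => exact ih.tail ⟨ht i.castSucc_lt_succ, h i⟩
    have hn := hi (Fin.last n)
    rw [h1, Relation.reflTransGen_iff_eq_or_transGen] at hn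
    exact hn.resolve_left one_ne_zero
  · suffices ∀ a b : ℝ, Relation.TransGen (fun a b ↦ a < b ∧ P (Icc a b)) a b →
      ∃ (n : ℕ) (t : Fin (n + 1) → ℝ), StrictMono t ∧ t 0 = a ∧ t (Fin.last n) = b ∧
        ∀ i : Fin n, P (Icc (t i.castSucc) (t i.succ)) from this 0 1
    intro a b h
    have h' := h.to_reflTransGen
    clear h
    induction h' with
    | refl =>
      exact ⟨0, fun _ ↦ a, Fin.strictMono_iff_lt_succ.2 fun i ↦ i.elim0, rfl, rfl, fun i ↦ i.elim0⟩
    | @tail b c _ hbc ih =>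
      obtain ⟨n, t, ht, h0, h1, h⟩ := ih
      refine ⟨n + 1, Fin.snoc (α := fun _ ↦ ℝ) t c, ?_, ?_, ?_, fun i ↦ ?_⟩
      · rw [Fin.strictMono_iff_lt_succ]
        intro i
        induction i using Fin.lastCases with
        | last => simpa [h1] using hbc.1
        | cast i => simpa [← Fin.castSucc_succ] using ht i.castSucc_lt_succ
      · rw [← Fin.castSucc_zero, Fin.snoc_castSucc, h0]
      · simp
      · induction i using Fin.lastCases with
        | last => simpa [h1] using hbc.2
        | cast i => simpa [← Fin.castSucc_succ] using h i

/-- `P` passes from an interval to its subintervals. -/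
def IccHereditary (P : Set ℝ → Prop) : Prop :=
  ∀ ⦃a b c d : ℝ⦄, a ≤ c → c < d → d ≤ b → P (Icc a b) → P (Icc c d)

/-- Common refinement: each piece for `Q` is cut at the division points of the chain for `P`. -/
theorem OnPieces.and {P Q : Set ℝ → Prop} (hP' : IccHereditary P) (hQ' : IccHereditary Q)
    (hP : OnPieces P) (hQ : OnPieces Q) : OnPieces fun s ↦ P s ∧ Q s := by
  rw [onPieces_iff_transGen] at hP hQ ⊢
  have hl {R : Set ℝ → Prop} {a b : ℝ} (h : Relation.TransGen (fun a b ↦ a < b ∧ R (Icc a b)) a b) :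
      a < b := by
    induction h with
    | single h => exact h.1
    | tail _ h ih => exact ih.trans h.1
  have h1 {a b : ℝ} (h : Relation.TransGen (fun a b ↦ a < b ∧ P (Icc a b)) a b) :
      ∀ c d, a ≤ c → c < d → d ≤ b → Q (Icc c d) →
        Relation.TransGen (fun a b ↦ a < b ∧ P (Icc a b) ∧ Q (Icc a b)) c d := by
    induction h using Relation.TransGen.trans_induction_on with
    | single h => exact fun c d hc hcd hd hQ ↦ .single ⟨hcd, hP' hc hcd hd h.2, hQ⟩
    | @trans a m b _ _ ih₁ ih₂ =>
      intro c d hc hcd hd hQ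
      rcases le_or_gt d m with hm | hm
      · exact ih₁ c d hc hcd hm hQ
      rcases le_or_gt m c with hm' | hm'
      · exact ih₂ c d hm' hcd hd hQ
      exact (ih₁ c m hc hm' le_rfl (hQ' le_rfl hm' hm.le hQ)).trans
        (ih₂ m d le_rfl hm hd (hQ' hm'.le hm le_rfl hQ))
  suffices ∀ a b, Relation.TransGen (fun a b ↦ a < b ∧ Q (Icc a b)) a b → 0 ≤ a → b ≤ 1 →
    Relation.TransGen (fun a b ↦ a < b ∧ P (Icc a b) ∧ Q (Icc a b)) a b from
      this 0 1 hQ le_rfl le_rfl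
  intro a b h
  induction h using Relation.TransGen.trans_induction_on with
  | single h => exact fun ha hb ↦ h1 hP _ _ ha h.1 hb h.2
  | trans h₁ h₂ ih₁ ih₂ =>
    exact fun ha hb ↦ (ih₁ ha ((hl h₂).le.trans hb)).trans (ih₂ (ha.trans (hl h₁).le) hb)

/-- The endpoints `0` and `1` are joined by a chain of pieces contained in `[0, 1]`. -/
theorem OnPieces.transGen_subset_Icc {P : Set ℝ → Prop} (hP' : IccHereditary P) (hP : OnPieces P) :
    Relation.TransGen (fun a b ↦ a < b ∧ Icc a b ⊆ Icc 0 1 ∧ P (Icc a b)) 0 1 := by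
  have h : OnPieces fun s ↦ s ⊆ Icc 0 1 := onPieces_of_Icc subset_rfl
  exact onPieces_iff_transGen.1 (h.and (fun a b c d h1 _ h2 h ↦ (Icc_subset_Icc h1 h2).trans h)
    hP' hP)

theorem OnPieces.trans {P Q R : Set ℝ → Prop} (hP' : IccHereditary P) (hQ' : IccHereditary Q)
    (hP : OnPieces P) (hQ : OnPieces Q)
    (h₁ : ∀ a b, a < b → Icc a b ⊆ Icc 0 1 → P (Icc a b) → R (Icc (a / 2) (b / 2)))
    (h₂ : ∀ a b, a < b → Icc a b ⊆ Icc 0 1 → Q (Icc a b) →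
      R (Icc ((a + 1) / 2) ((b + 1) / 2))) : OnPieces R := by
  rw [onPieces_iff_transGen]
  have h1 := (hP.transGen_subset_Icc hP').lift (p := fun a b ↦ a < b ∧ R (Icc a b)) (fun a ↦ a / 2)
    fun a b h ↦ ⟨by linarith [h.1], h₁ a b h.1 h.2.1 h.2.2⟩
  have h2 := (hQ.transGen_subset_Icc hQ').lift (p := fun a b ↦ a < b ∧ R (Icc a b))
    (fun a ↦ (a + 1) / 2) fun a b h ↦ ⟨by linarith [h.1], h₂ a b h.1 h.2.1 h.2.2⟩
  norm_num [Function.onFun] at h1 h2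
  exact h1.trans h2

end Pieces

/-! ### Chain rule and locality for the covariant derivative along a map. -/

section CovDeriv

variable {E : Type*} [NormedAddCommGroup E] [NormedSpace ℝ E]
  {N : Type*} [TopologicalSpace N] [ChartedSpace E N] [IsManifold 𝓘(ℝ, E) ∞ N]
  {nabla : CovariantDerivative 𝓘(ℝ, E) E (fun y : N ↦ TangentSpace 𝓘(ℝ, E) y)}
  {F : Type*} [NormedAddCommGroup F] [NormedSpace ℝ F]
  {M : Type*} [TopologicalSpace M] [ChartedSpace F M]
  {F' : Type*} [NormedAddCommGroup F'] [NormedSpace ℝ F']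
  {M' : Type*} [TopologicalSpace M'] [ChartedSpace F' M']

theorem covDerivWithin_comp {Y : M → TangentBundle 𝓘(ℝ, E) N} {s : Set M} {s' : Set M'}
    {g : M' → M} {p : M'}
    (hY : MDifferentiableWithinAt 𝓘(ℝ, F) (𝓘(ℝ, E).prod 𝓘(ℝ, E)) Y s (g p))
    (hg : MDifferentiableWithinAt 𝓘(ℝ, F') 𝓘(ℝ, F) g s' p) (h : MapsTo g s' s)
    (hs' : UniqueMDiffWithinAt 𝓘(ℝ, F') s' p) (w : TangentSpace 𝓘(ℝ, F') p) :
    covDerivWithin nabla (Y ∘ g) s' p w =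
      covDerivWithin nabla Y s (g p) (mfderivWithin 𝓘(ℝ, F') 𝓘(ℝ, F) g s' p w) := by
  set e := trivializationAt E (TangentSpace 𝓘(ℝ, E)) (Y (g p)).proj with he
  obtain ⟨hYp, hYe⟩ := (e.mdifferentiableWithinAt_totalSpace_iff _ Y
    (e.mem_source.2 (FiberBundle.mem_baseSet_trivializationAt' _))).1 hY
  have h1 := DFunLike.congr_fun (mfderivWithin_comp (I := 𝓘(ℝ, F')) (I' := 𝓘(ℝ, F))
    (I'' := 𝓘(ℝ, E)) p hYp hg h hs') w
  have h2 := DFunLike.congr_fun (mfderivWithin_comp (I := 𝓘(ℝ, F')) (I' := 𝓘(ℝ, F))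
    (I'' := 𝓘(ℝ, E)) p hYe hg h hs') w
  exact congrArg₂ (fun (a : E) (b : TangentSpace 𝓘(ℝ, E) (Y (g p)).proj) ↦
    e.symm (Y (g p)).proj a + nabla (FiberBundle.extend E (Y (g p)).2) (Y (g p)).proj b) h2 h1

/-- Only vanishing is compared, since the two derivatives lie in the fibres over `(Y p).proj` and
`(Y' p).proj`, which are not definitionally equal. -/
theorem covDerivWithin_eq_zero_congr {Y Y' : M → TangentBundle 𝓘(ℝ, E) N} {s : Set M} {p : M}
    (h : EqOn Y Y' s) (hp : p ∈ s) (w : TangentSpace 𝓘(ℝ, F) p) :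
    covDerivWithin nabla Y s p w = 0 ↔ covDerivWithin nabla Y' s p w = 0 := by
  have hpq : Y p = Y' p := h hp
  obtain ⟨d, hd⟩ : ∃ d : TangentBundle 𝓘(ℝ, E) N → TangentSpace 𝓘(ℝ, F) p → E, ∀ q w,
      d q w = mvfderivWithin 𝓘(ℝ, F)
        (fun x ↦ (trivializationAt E (TangentSpace 𝓘(ℝ, E)) q.proj (Y' x)).2) s p w :=
    ⟨_, fun _ _ ↦ rfl⟩
  obtain ⟨b, hb⟩ : ∃ b : TangentSpace 𝓘(ℝ, F) p → E, ∀ w,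
      b w = mfderivWithin 𝓘(ℝ, F) 𝓘(ℝ, E) (fun x ↦ (Y' x).proj) s p w := ⟨_, fun _ ↦ rfl⟩
  have key (Z : M → TangentBundle 𝓘(ℝ, E) N) (hZ : EqOn Z Y' s) (q : TangentBundle 𝓘(ℝ, E) N)
      (hq : Z p = q) : covDerivWithin nabla Z s p w = 0 ↔
      (trivializationAt E (TangentSpace 𝓘(ℝ, E)) q.proj).symm q.proj (d q w)
      + nabla (FiberBundle.extend E q.2) q.proj (b w) = 0 := by
    subst hq
    rw [covDerivWithin]
    have h1 := (hd (Z p) w).trans (mvfderivWithin_congr_of_eventuallyEq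
      (u := fun x ↦ (trivializationAt E (TangentSpace 𝓘(ℝ, E)) (Z p).proj (Y' x)).2)
      (v := fun x ↦ (trivializationAt E (TangentSpace 𝓘(ℝ, E)) (Z p).proj (Z x)).2)
      (Filter.eventuallyEq_of_mem self_mem_nhdsWithin fun x hx ↦ by rw [hZ hx]) (by rw [hZ hp]) w)
    have h2 := (hb w).trans (DFunLike.congr_fun (mfderivWithin_congr (I := 𝓘(ℝ, F)) (I' := 𝓘(ℝ, E))
      (f := fun x ↦ (Z x).proj) (f₁ := fun x ↦ (Y' x).proj)
      (fun x hx ↦ by rw [hZ hx]) (by rw [hZ hp])) w)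
    rw [h1]
    generalize b w = b at h2
    subst h2
    rfl
  exact (key Y h (Y' p) hpq).trans (key Y' (fun _ _ ↦ rfl) (Y' p) rfl).symm

variable (nabla) in
/-- `V` is smooth and parallel on the piece `s` of an interval. -/
def IsParallelOn (V : ℝ → TangentBundle 𝓘(ℝ, E) N) (s : Set ℝ) : Prop :=
  ContMDiffOn 𝓘(ℝ, ℝ) (𝓘(ℝ, E).prod 𝓘(ℝ, E)) ∞ V s ∧
    ∀ t ∈ s, covDerivWithin (F := ℝ) nabla V s t (1 : ℝ) = 0

theorem IsParallelOn.congr {V V' : ℝ → TangentBundle 𝓘(ℝ, E) N} {s : Set ℝ}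
    (hV : IsParallelOn nabla V s) (h : EqOn V' V s) : IsParallelOn nabla V' s :=
  ⟨hV.1.congr h, fun t ht ↦ (covDerivWithin_eq_zero_congr h ht _).2 (hV.2 t ht)⟩

theorem covDerivWithin_smul {Y : M → TangentBundle 𝓘(ℝ, E) N} {s : Set M} {p : M} (c : ℝ)
    (w : TangentSpace 𝓘(ℝ, F) p) (h : covDerivWithin nabla Y s p w = 0) :
    covDerivWithin nabla Y s p (c • w) = 0 := by
  have hp : (Y p).proj ∈ (trivializationAt E (TangentSpace 𝓘(ℝ, E)) (Y p).proj).baseSet :=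
    FiberBundle.mem_baseSet_trivializationAt' _
  rw [covDerivWithin, ← Trivialization.symmL_apply (R := ℝ) _ hp] at h ⊢
  rw [map_smul, map_smul, map_smul, map_smul, ← smul_add, h, smul_zero]

/-- Reparametrization multiplies the velocity by a scalar, and the covariant derivative is linear in
the direction. Taking `g = id` gives restriction to a subinterval. -/
theorem IsParallelOn.comp {V : ℝ → TangentBundle 𝓘(ℝ, E) N} {s s' : Set ℝ}
    (hV : IsParallelOn nabla V s) {g : ℝ → ℝ} (hg : ContDiff ℝ ∞ g) (h : MapsTo g s' s)
    (hs' : UniqueDiffOn ℝ s') : IsParallelOn nabla (V ∘ g) s' := by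
  refine ⟨hV.1.comp hg.contMDiff.contMDiffOn h, fun t ht ↦ ?_⟩
  refine (covDerivWithin_comp ((hV.1 _ (h ht)).mdifferentiableWithinAt (by simp))
    ((hg.contMDiff.contMDiffAt).mdifferentiableAt (by simp)).mdifferentiableWithinAt h
    (hs' t ht).uniqueMDiffWithinAt _).trans ?_
  obtain ⟨d, hd⟩ : ∃ d : ℝ, d = mfderivWithin 𝓘(ℝ, ℝ) 𝓘(ℝ, ℝ) g s' t (1 : ℝ) := ⟨_, rfl⟩
  have h1 := covDerivWithin_smul d _ (hV.2 _ (h ht))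
  have h2 : d • (1 : ℝ) = d := by simp
  rw [← hd]
  exact (congrArg (covDerivWithin (F := ℝ) nabla V s (g t)) h2).symm.trans h1

theorem iccHereditary_isParallelOn (V : ℝ → TangentBundle 𝓘(ℝ, E) N) :
    IccHereditary (IsParallelOn nabla V) := fun _ _ _ _ h1 h h2 hV ↦
  hV.comp (g := id) contDiff_id (Icc_subset_Icc h1 h2) (uniqueDiffOn_Icc h)

end CovDeriv

/-! ### Parallel fields along paths, and concatenation of transports. -/

section Paths

variable {E : Type*} [NormedAddCommGroup E] [NormedSpace ℝ E]
  {N : Type*} [TopologicalSpace N] [ChartedSpace E N] [IsManifold 𝓘(ℝ, E) ∞ N]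
  {nabla : CovariantDerivative 𝓘(ℝ, E) E (fun y : N ↦ TangentSpace 𝓘(ℝ, E) y)}
  {F : Type*} [NormedAddCommGroup F] [NormedSpace ℝ F]
  {M : Type*} [TopologicalSpace M] [ChartedSpace F M] {f : M → N}

theorem iccHereditary_contMDiffOn (g : ℝ → M) :
    IccHereditary fun s ↦ ContMDiffOn 𝓘(ℝ, ℝ) 𝓘(ℝ, F) ∞ g s :=
  fun _ _ _ _ h1 _ h2 h ↦ h.mono (Icc_subset_Icc h1 h2)

theorem IsParallelField.isParallelOn {X : M → TangentBundle 𝓘(ℝ, E) N}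
    (hX : IsParallelField (F := F) nabla f X) {g : ℝ → M} {s : Set ℝ} (hs : UniqueDiffOn ℝ s)
    (hg : ContMDiffOn 𝓘(ℝ, ℝ) 𝓘(ℝ, F) ∞ g s) : IsParallelOn nabla (X ∘ g) s := by
  refine ⟨hX.smooth.comp_contMDiffOn hg, fun t ht ↦ ?_⟩
  refine (covDerivWithin_comp (hX.smooth.mdifferentiable (by simp) _).mdifferentiableWithinAt
    ((hg t ht).mdifferentiableWithinAt (by simp)) (mapsTo_univ _ _)
    (hs t ht).uniqueMDiffWithinAt _).trans ?_
  exact hX.parallel _ _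

theorem IsParallelField.isParallelAlongCurve {X : M → TangentBundle 𝓘(ℝ, E) N}
    (hX : IsParallelField (F := F) nabla f X) {x y : M} {γ : Path x y}
    (hγ : IsPiecewiseSmooth (F := F) γ) :
    IsParallelAlongCurve nabla (fun t ↦ f (γ.extend t)) (X ∘ γ.extend) := by
  refine ⟨fun t _ ↦ hX.proj_eq _, ?_⟩
  change OnPieces (IsParallelOn nabla (X ∘ γ.extend))
  rw [onPieces_iff_transGen]
  exact (onPieces_iff_transGen.1 hγ).lift id fun a b h ↦
    ⟨h.1, hX.isParallelOn (uniqueDiffOn_Icc h.1) h.2⟩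

theorem IsPathTransport.trans {x y z : M}
    {P : TangentSpace 𝓘(ℝ, E) (f x) ≃ₗ[ℝ] TangentSpace 𝓘(ℝ, E) (f y)}
    {Q : TangentSpace 𝓘(ℝ, E) (f y) ≃ₗ[ℝ] TangentSpace 𝓘(ℝ, E) (f z)}
    (hP : IsPathTransport nabla F f P) (hQ : IsPathTransport nabla F f Q) :
    IsPathTransport nabla F f (P.trans Q) := by
  obtain ⟨γ, hγ, hP⟩ := hP
  obtain ⟨γ', hγ', hQ⟩ := hQ
  have hl : ∀ a b, a < b → MapsTo (fun t : ℝ ↦ 2 * t) (Icc (a / 2) (b / 2)) (Icc a b) :=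
    fun a b _ t ht ↦ ⟨by linarith [ht.1], by linarith [ht.2]⟩
  have hr : ∀ a b, a < b → MapsTo (fun t : ℝ ↦ 2 * t - 1) (Icc ((a + 1) / 2) ((b + 1) / 2))
    (Icc a b) := fun a b _ t ht ↦ ⟨by linarith [ht.1], by linarith [ht.2]⟩
  have hl' : ∀ a b, Icc a b ⊆ Icc 0 1 → ∀ t ∈ Icc (a / 2) (b / 2), t ≤ (1 : ℝ) / 2 :=
    fun a b h t ht ↦ by
      have := (h (right_mem_Icc.2 (by linarith [ht.1, ht.2]))).2
      linarith [ht.2]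
  have hr' : ∀ a b, Icc a b ⊆ Icc 0 1 → ∀ t ∈ Icc ((a + 1) / 2) ((b + 1) / 2), (1 : ℝ) / 2 ≤ t :=
    fun a b h t ht ↦ by
      have := (h (left_mem_Icc.2 (by linarith [ht.1, ht.2]))).1
      linarith [ht.1]
  have hI : ∀ a b, Icc a b ⊆ Icc (0 : ℝ) 1 → ∀ t ∈ Icc (a / 2) (b / 2), t ∈ Icc (0 : ℝ) 1 :=
    fun a b h t ht ↦ by
      have := (h (left_mem_Icc.2 (by linarith [ht.1, ht.2]))).1
      exact ⟨by linarith [ht.1], (hl' a b h t ht).trans (by norm_num)⟩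
  have hI' : ∀ a b, Icc a b ⊆ Icc (0 : ℝ) 1 → ∀ t ∈ Icc ((a + 1) / 2) ((b + 1) / 2),
    t ∈ Icc (0 : ℝ) 1 := fun a b h t ht ↦ by
      have := (h (right_mem_Icc.2 (by linarith [ht.1, ht.2]))).2
      exact ⟨le_trans (by norm_num) (hr' a b h t ht), by linarith [ht.2]⟩
  have ht₁ (t : ℝ) (ht : t ∈ Icc (0 : ℝ) 1) (h : t ≤ 1 / 2) :
      (γ.trans γ').extend t = γ.extend (2 * t) := by
    rw [Path.extend_apply _ ht]
    exact if_pos h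
  have ht₂ (t : ℝ) (ht : t ∈ Icc (0 : ℝ) 1) (h : 1 / 2 ≤ t) :
      (γ.trans γ').extend t = γ'.extend (2 * t - 1) := by
    rcases h.eq_or_lt with rfl | h
    · rw [ht₁ _ ht le_rfl]
      norm_num
    · rw [Path.extend_apply _ ht]
      exact if_neg h.not_ge
  refine ⟨γ.trans γ', hγ.trans (iccHereditary_contMDiffOn _) (iccHereditary_contMDiffOn _) hγ'
    (fun a b hab h hs ↦ ?_) (fun a b hab h hs ↦ ?_), fun v ↦ ?_⟩
  · exact (hs.comp (contDiff_const.mul contDiff_id).contMDiff.contMDiffOn (hl a b hab)).congr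
      fun t ht ↦ ht₁ t (hI a b h t ht) (hl' a b h t ht)
  · exact (hs.comp ((contDiff_const.mul contDiff_id).sub contDiff_const).contMDiff.contMDiffOn
      (hr a b hab)).congr fun t ht ↦ ht₂ t (hI' a b h t ht) (hr' a b h t ht)
  obtain ⟨V, hV, hV0, hV1⟩ := hP v
  obtain ⟨V', hV', hV0', hV1'⟩ := hQ (P v)
  obtain ⟨W, hW⟩ : ∃ W : ℝ → TangentBundle 𝓘(ℝ, E) N,
      W = fun t ↦ if t ≤ 1 / 2 then V (2 * t) else V' (2 * t - 1) := ⟨_, rfl⟩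
  have hW₁ (t : ℝ) (h : t ≤ 1 / 2) : W t = V (2 * t) := by
    rw [hW]
    exact if_pos h
  -- The pieces are closed, so the second formula is also needed at `t = 1 / 2`; there `V 1 = V' 0`.
  have hW₂ (t : ℝ) (h : 1 / 2 ≤ t) : W t = V' (2 * t - 1) := by
    rcases h.eq_or_lt with rfl | h
    · rw [hW₁ _ le_rfl]
      norm_num [hV1, hV0']
    · rw [hW]
      exact if_neg h.not_ge
  refine ⟨W, ⟨fun t ht ↦ ?_, ?_⟩, ?_, ?_⟩
  · rcases le_total t (1 / 2) with h | h
    · rw [hW₁ t h, ht₁ t ht h]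
      exact hV.proj_eq _ ⟨by linarith [ht.1], by linarith⟩
    · rw [hW₂ t h, ht₂ t ht h]
      exact hV'.proj_eq _ ⟨by linarith, by linarith [ht.2]⟩
  · refine OnPieces.trans (iccHereditary_isParallelOn V) (iccHereditary_isParallelOn V')
      hV.parallel hV'.parallel (R := IsParallelOn nabla W) (fun a b hab h hs ↦ ?_)
      (fun a b hab h hs ↦ ?_)
    · exact (hs.comp (contDiff_const.mul contDiff_id) (hl a b hab)
        (uniqueDiffOn_Icc (by linarith))).congr fun t ht ↦ hW₁ t (hl' a b h t ht)
    · exact (hs.comp ((contDiff_const.mul contDiff_id).sub contDiff_const) (hr a b hab)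
        (uniqueDiffOn_Icc (by linarith))).congr fun t ht ↦ hW₂ t (hr' a b h t ht)
  · rw [hW₁ 0 (by norm_num), mul_zero, hV0]
  · rw [hW₂ 1 (by norm_num)]
    norm_num [hV1']

end Paths

/-! ### Uniqueness of parallel fields along a curve. -/

section Uniqueness

variable {E : Type*} [NormedAddCommGroup E] [NormedSpace ℝ E] [FiniteDimensional ℝ E]
  {N : Type*} [TopologicalSpace N] [ChartedSpace E N] [IsManifold 𝓘(ℝ, E) ∞ N]
  {nabla : CovariantDerivative 𝓘(ℝ, E) E (fun y : N ↦ TangentSpace 𝓘(ℝ, E) y)}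

theorem exists_Icc_mem_nhdsWithin {a b t : ℝ} (hab : a < b) (ht : t ∈ Icc a b) {s : Set ℝ}
    (hs : s ∈ 𝓝[Icc a b] t) : ∃ a' b', a ≤ a' ∧ a' < b' ∧ b' ≤ b ∧ t ∈ Icc a' b' ∧
      Icc a' b' ∈ 𝓝[Icc a b] t ∧ Icc a' b' ⊆ s := by
  obtain ⟨ε, hε, h⟩ := Metric.mem_nhdsWithin_iff.1 hs
  refine ⟨max a (t - ε / 2), min b (t + ε / 2), le_max_left _ _, ?_, min_le_left _ _, ?_, ?_,
    fun z hz ↦ h ⟨?_, ?_⟩⟩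
  · rw [max_lt_iff, lt_min_iff, lt_min_iff]
    exact ⟨⟨hab, by linarith [ht.1]⟩, by linarith [ht.2], by linarith⟩
  · exact ⟨max_le ht.1 (by linarith), le_min ht.2 (by linarith)⟩
  · rw [← Icc_inter_Icc, inter_comm]
    exact Filter.inter_mem (mem_nhdsWithin_of_mem_nhds (Icc_mem_nhds (by linarith) (by linarith)))
      self_mem_nhdsWithin
  · have h1 := (le_max_right _ _).trans hz.1
    have h2 := hz.2.trans (min_le_right _ _)
    rw [Metric.mem_ball, Real.dist_eq, abs_lt]
    constructor <;> linarith
  · exact ⟨(le_max_left _ _).trans hz.1, hz.2.trans (min_le_left _ _)⟩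

/-- Near each point, parallel fields along the same curve which agree somewhere agree. -/
theorem IsParallelOn.eventually_eq_iff [T2Space N] (hnabla : nabla.ContMDiffCovariantDerivative ∞)
    {V V' : ℝ → TangentBundle 𝓘(ℝ, E) N} {a b t₀ : ℝ} (hab : a < b)
    (hV : IsParallelOn nabla V (Icc a b)) (hV' : IsParallelOn nabla V' (Icc a b))
    (hp : ∀ t ∈ Icc a b, (V t).proj = (V' t).proj) (ht₀ : t₀ ∈ Icc a b) :
    ∀ᶠ t in 𝓝[Icc a b] t₀, V t = V' t ↔ V t₀ = V' t₀ := by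
  set e := trivializationAt E (TangentSpace 𝓘(ℝ, E)) (V t₀).proj with he
  obtain ⟨U, hU, hpU, hUe, hUn⟩ := exists_contMDiffOn_nabla_symm_const e hnabla
    (FiberBundle.mem_baseSet_trivializationAt' (V t₀).proj)
  have hg : ContMDiffOn 𝓘(ℝ, ℝ) 𝓘(ℝ, E) ∞ (fun t ↦ (V t).proj) (Icc a b) :=
    (contMDiff_proj _).comp_contMDiffOn hV.1
  obtain ⟨a', b', haa', hab', hbb', ht₀', hnhds, hsub⟩ := exists_Icc_mem_nhdsWithin hab ht₀
    ((hg.continuousOn t₀ ht₀) (hU.mem_nhds hpU))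
  have hun := uniqueDiffOn_Icc hab'
  have hI : Icc a' b' ⊆ Icc a b := Icc_subset_Icc haa' hbb'
  obtain ⟨A, hA, hAg⟩ := exists_contDiffOn_connectionForm e hUe hUn hun (hg.mono hI) hsub
  -- Both fields lie over the same curve, hence their coordinates solve one linear ODE, with `A`
  -- computed from `V`.
  have hode {W : ℝ → TangentBundle 𝓘(ℝ, E) N} (hW : IsParallelOn nabla W (Icc a' b'))
      (hpW : ∀ t ∈ Icc a' b', (V t).proj = (W t).proj) : ∀ t ∈ Icc a' b',
      HasDerivWithinAt (fun t ↦ (e (W t)).2)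
        ((-(ContinuousLinearMap.apply ℝ E (1 : ℝ)).comp (A t)) (e (W t)).2) (Icc a' b') t := by
    intro t ht
    have hm : (V t).proj ∈ e.baseSet := hUe (hsub ht)
    have h := (covDerivWithin_one_eq_zero_iff ((hW.1 t ht).mdifferentiableWithinAt (by simp))
      (hun t ht) (hpW t ht ▸ hm)).1 (hW.2 t ht)
    convert h using 1
    refine congrArg Neg.neg ((hAg t ht _ _).trans ?_)
    obtain ⟨d, hd⟩ : ∃ d : (ℝ → N) → E, ∀ g,
        d g = mfderivWithin 𝓘(ℝ, ℝ) 𝓘(ℝ, E) g (Icc a' b') t (1 : ℝ) := ⟨_, fun _ ↦ rfl⟩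
    have h1 : d (fun t ↦ (V t).proj) = d fun t ↦ (W t).proj := by
      rw [hd, hd]
      exact DFunLike.congr_fun (mfderivWithin_congr (I := 𝓘(ℝ, ℝ)) (I' := 𝓘(ℝ, E))
        (f₁ := fun t ↦ (V t).proj) (f := fun t ↦ (W t).proj) hpW (hpW t ht)) (1 : ℝ)
    have h2 (q q' : N) (hq : q = q') (a w : E) :
        (e ⟨q, nabla (fun z ↦ e.symm z a) q w⟩).2 = (e ⟨q', nabla (fun z ↦ e.symm z a) q' w⟩).2 := by
      subst hq
      rfl
    refine (h2 _ _ (hpW t ht) _ _).trans ?_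
    have h3 := (hd fun t ↦ (V t).proj).symm.trans (h1.trans (hd fun t ↦ (W t).proj))
    exact congrArg (fun w : E ↦ (e ⟨(W t).proj,
      nabla (fun z ↦ e.symm z (e (W t)).2) (W t).proj w⟩).2) h3
  have hu := hode (iccHereditary_isParallelOn V haa' hab' hbb' hV) fun _ _ ↦ rfl
  have hu' := hode (iccHereditary_isParallelOn V' haa' hab' hbb' hV') fun t ht ↦ hp t (hI ht)
  have hB : ContinuousOn (fun t ↦ -(ContinuousLinearMap.apply ℝ E (1 : ℝ)).comp (A t))
      (Icc a' b') := (continuousOn_const.clm_comp hA.continuousOn).neg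
  have hiff : ∀ t ∈ Icc a' b', V t = V' t ↔ (e (V t)).2 = (e (V' t)).2 := fun t ht ↦ by
    refine ⟨fun h ↦ by rw [h], fun h ↦ ?_⟩
    have hm : (V t).proj ∈ e.baseSet := hUe (hsub ht)
    refine e.injOn (e.mem_source.2 hm) (e.mem_source.2 (hp t (hI ht) ▸ hm)) (Prod.ext ?_ h)
    exact (e.coe_fst (e.mem_source.2 hm)).trans ((hp t (hI ht)).trans
      (e.coe_fst (e.mem_source.2 (hp t (hI ht) ▸ hm))).symm)
  filter_upwards [hnhds] with t ht
  rw [hiff t ht, hiff t₀ ht₀']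
  exact ⟨fun h ↦ eqOn_of_hasDerivWithinAt_linear hB hu hu' ht h ht₀',
    fun h ↦ eqOn_of_hasDerivWithinAt_linear hB hu hu' ht₀' h ht⟩

/-- Agreement is locally constant in the parameter, and the interval is connected. -/
theorem IsParallelOn.eq_of_eq_left [T2Space N] (hnabla : nabla.ContMDiffCovariantDerivative ∞)
    {V V' : ℝ → TangentBundle 𝓘(ℝ, E) N} {a b : ℝ} (hab : a < b)
    (hV : IsParallelOn nabla V (Icc a b)) (hV' : IsParallelOn nabla V' (Icc a b))
    (hp : ∀ t ∈ Icc a b, (V t).proj = (V' t).proj) (h : V a = V' a) : V b = V' b := by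
  refine isPreconnected_Icc.induction₂' (fun x y ↦ V x = V' x → V y = V' y) (fun x hx ↦ ?_)
    (fun _ _ _ _ _ _ h₁ h₂ h ↦ h₂ (h₁ h)) (left_mem_Icc.2 hab.le) (right_mem_Icc.2 hab.le) h
  filter_upwards [hV.eventually_eq_iff hnabla hab hV' hp hx] with y hy
  exact ⟨hy.2, hy.1⟩

theorem IsParallelAlongCurve.eq_one_of_eq_zero [T2Space N]
    (hnabla : nabla.ContMDiffCovariantDerivative ∞) {V V' : ℝ → TangentBundle 𝓘(ℝ, E) N}
    {c : ℝ → N} (hV : IsParallelAlongCurve nabla c V) (hV' : IsParallelAlongCurve nabla c V')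
    (h : V 0 = V' 0) : V 1 = V' 1 := by
  -- A common subdivision for both fields, with pieces kept inside `[0, 1]`, where the base curves
  -- are known to agree.
  have hP := OnPieces.transGen_subset_Icc (fun a b c d h1 h h2 h3 ↦
    ⟨iccHereditary_isParallelOn V h1 h h2 h3.1, iccHereditary_isParallelOn V' h1 h h2 h3.2⟩)
    (OnPieces.and (iccHereditary_isParallelOn V) (iccHereditary_isParallelOn V') hV.parallel
      hV'.parallel)
  refine Relation.TransGen.trans_induction_on (motive := fun {a b} _ ↦ V a = V' a → V b = V' b) hP
    (fun h ↦ ?_) (fun _ _ h₁ h₂ h ↦ h₂ (h₁ h)) h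
  exact h.2.2.1.eq_of_eq_left hnabla h.1 h.2.2.2 fun t ht ↦
    (hV.proj_eq t (h.2.1 ht)).trans (hV'.proj_eq t (h.2.1 ht)).symm

variable {F : Type*} [NormedAddCommGroup F] [NormedSpace ℝ F]
  {M : Type*} [TopologicalSpace M] [ChartedSpace F M] {f : M → N}

theorem IsParallelField.eq_of_isPathTransport [T2Space N]
    (hnabla : nabla.ContMDiffCovariantDerivative ∞) {X : M → TangentBundle 𝓘(ℝ, E) N}
    (hX : IsParallelField (F := F) nabla f X) {x y : M}
    {P : TangentSpace 𝓘(ℝ, E) (f x) ≃ₗ[ℝ] TangentSpace 𝓘(ℝ, E) (f y)}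
    (hP : IsPathTransport nabla F f P) {v : TangentSpace 𝓘(ℝ, E) (f x)} (h : X x = ⟨f x, v⟩) :
    X y = ⟨f y, P v⟩ := by
  obtain ⟨γ, hγ, hP⟩ := hP
  obtain ⟨V, hV, hV0, hV1⟩ := hP v
  rw [← hV1]
  have := (hX.isParallelAlongCurve hγ).eq_one_of_eq_zero hnabla hV (by simp [h, hV0])
  simpa using this

end Uniqueness

/-! ### The field obtained by transporting a holonomy-invariant vector. -/

section Existence

variable {E : Type*} [NormedAddCommGroup E] [NormedSpace ℝ E]
  {N : Type*} [TopologicalSpace N] [ChartedSpace E N] [IsManifold 𝓘(ℝ, E) ∞ N]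
  (nabla : CovariantDerivative 𝓘(ℝ, E) E (fun y : N ↦ TangentSpace 𝓘(ℝ, E) y))
  {F : Type*} [NormedAddCommGroup F] [NormedSpace ℝ F]
  {M : Type*} [TopologicalSpace M] [ChartedSpace F M] (f : M → N)

variable (F) in
/-- `x` and `p` are joined in both directions by piecewise smooth paths with a parallel
transport. -/
def TransportJoined (x p : M) : Prop :=
  (∃ P, IsPathTransport nabla F f (x := x) (y := p) P) ∧
    ∃ P, IsPathTransport nabla F f (x := p) (y := x) P

variable (F) in
open Classical in
/-- The vector field obtained from `W` by parallel transport along paths from `x`, extended by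
zero to the other components. -/
noncomputable def transportField (x : M) (W : TangentSpace 𝓘(ℝ, E) (f x)) (p : M) :
    TangentSpace 𝓘(ℝ, E) (f p) :=
  if h : TransportJoined nabla F f x p then h.1.choose W else 0

variable {nabla f}

theorem TransportJoined.trans {x y z : M} (h : TransportJoined nabla F f x y)
    (h' : TransportJoined nabla F f y z) : TransportJoined nabla F f x z := by
  obtain ⟨⟨P, hP⟩, ⟨R, hR⟩⟩ := h
  obtain ⟨⟨P', hP'⟩, ⟨R', hR'⟩⟩ := h'
  exact ⟨⟨_, hP.trans hP'⟩, ⟨_, hR'.trans hR⟩⟩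

theorem TransportJoined.symm {x y : M} (h : TransportJoined nabla F f x y) :
    TransportJoined nabla F f y x := ⟨h.2, h.1⟩

/-- A return transport `R` from `p` to `x` closes both paths to loops, so `R (P W) = W = R (Q W)`,
and `R` is injective. This is why `TransportJoined` asks for both directions. -/
theorem TransportJoined.apply_eq {x p : M} (h : TransportJoined nabla F f x p)
    {W : TangentSpace 𝓘(ℝ, E) (f x)}
    (hW : MulAction.stabilizer (relHolonomy (F := F) nabla f x) W = ⊤)
    {P Q : TangentSpace 𝓘(ℝ, E) (f x) ≃ₗ[ℝ] TangentSpace 𝓘(ℝ, E) (f p)}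
    (hP : IsPathTransport nabla F f P) (hQ : IsPathTransport nabla F f Q) : P W = Q W := by
  obtain ⟨R, hR⟩ := h.2
  have key {P : TangentSpace 𝓘(ℝ, E) (f x) ≃ₗ[ℝ] TangentSpace 𝓘(ℝ, E) (f p)}
      (hP : IsPathTransport nabla F f P) : R (P W) = W := by
    have hm : P.trans R ∈ relHolonomy (F := F) nabla f x := Subgroup.subset_closure (hP.trans hR)
    have : (⟨P.trans R, hm⟩ : relHolonomy (F := F) nabla f x) ∈
      MulAction.stabilizer (relHolonomy (F := F) nabla f x) W := hW ▸ Subgroup.mem_top _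
    exact this
  exact R.injective ((key hP).trans (key hQ).symm)

theorem TransportJoined.transportField_eq {x p : M} (h : TransportJoined nabla F f x p)
    {W : TangentSpace 𝓘(ℝ, E) (f x)}
    (hW : MulAction.stabilizer (relHolonomy (F := F) nabla f x) W = ⊤)
    {P : TangentSpace 𝓘(ℝ, E) (f x) ≃ₗ[ℝ] TangentSpace 𝓘(ℝ, E) (f p)}
    (hP : IsPathTransport nabla F f P) : transportField nabla F f x W p = P W := by
  rw [transportField, dif_pos h]
  exact h.apply_eq hW h.1.choose_spec hP

theorem TransportJoined.transportField_trans {x p q : M} (hpq : TransportJoined nabla F f p q)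
    {W : TangentSpace 𝓘(ℝ, E) (f x)}
    (hW : MulAction.stabilizer (relHolonomy (F := F) nabla f x) W = ⊤)
    {P : TangentSpace 𝓘(ℝ, E) (f p) ≃ₗ[ℝ] TangentSpace 𝓘(ℝ, E) (f q)}
    (hP : IsPathTransport nabla F f P) :
    transportField nabla F f x W q = P (transportField nabla F f x W p) := by
  by_cases h : TransportJoined nabla F f x p
  · obtain ⟨Q, hQ⟩ := h.1
    rw [(h.trans hpq).transportField_eq hW (hQ.trans hP), h.transportField_eq hW hQ]
    rfl
  -- If `p` is not reached from `x`, neither is `q`; both values are zero and `P` preserves zero.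
  · have h' : ¬ TransportJoined nabla F f x q := fun h' ↦ h (h'.trans hpq.symm)
    rw [transportField, transportField, dif_neg h, dif_neg h', map_zero]

theorem stabilizer_relHolonomy_eq_top_iff {x : M} {W : TangentSpace 𝓘(ℝ, E) (f x)} :
    MulAction.stabilizer (relHolonomy (F := F) nabla f x) W = ⊤ ↔
      ∀ P, IsPathTransport nabla F f (x := x) (y := x) P → P W = W := by
  constructor
  · intro h P hP
    have : (⟨P, Subgroup.subset_closure hP⟩ : relHolonomy (F := F) nabla f x) ∈
      MulAction.stabilizer (relHolonomy (F := F) nabla f x) W := h ▸ Subgroup.mem_top _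
    exact this
  · intro h
    have hle : relHolonomy (F := F) nabla f x ≤
        MulAction.stabilizer (TangentSpace 𝓘(ℝ, E) (f x) ≃ₗ[ℝ] TangentSpace 𝓘(ℝ, E) (f x)) W :=
      (Subgroup.closure_le _).2 fun P hP ↦ h P hP
    exact eq_top_iff.2 fun P _ ↦ hle P.2

theorem IsTransportBall.preimage_mem_nhds {p₀ : M} {r : ℝ}
    {A : F → E →L[ℝ] F →L[ℝ] E} (hA : IsTransportBall nabla f p₀ r A) :
    (extChartAt 𝓘(ℝ, F) p₀).source ∩
      extChartAt 𝓘(ℝ, F) p₀ ⁻¹' Metric.ball (extChartAt 𝓘(ℝ, F) p₀ p₀) r ∈ 𝓝 p₀ :=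
  Filter.inter_mem (extChartAt_source_mem_nhds p₀)
    ((continuousAt_extChartAt p₀) (Metric.ball_mem_nhds _ hA.pos))

variable [FiniteDimensional ℝ E] [IsManifold 𝓘(ℝ, F) ∞ M]

theorem IsTransportBall.transportJoined (hf : ContMDiff 𝓘(ℝ, F) 𝓘(ℝ, E) ∞ f) {p₀ : M} {r : ℝ}
    {A : F → E →L[ℝ] F →L[ℝ] E} (hA : IsTransportBall nabla f p₀ r A) {y y' : F}
    (hy : y ∈ Metric.ball (extChartAt 𝓘(ℝ, F) p₀ p₀) r)
    (hy' : y' ∈ Metric.ball (extChartAt 𝓘(ℝ, F) p₀ p₀) r) :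
    TransportJoined nabla F f ((extChartAt 𝓘(ℝ, F) p₀).symm y)
      ((extChartAt 𝓘(ℝ, F) p₀).symm y') := by
  obtain ⟨P, hP, -⟩ := hA.exists_isPathTransport hf hy hy'
  obtain ⟨Q, hQ, -⟩ := hA.exists_isPathTransport hf hy' hy
  exact ⟨⟨P, hP⟩, ⟨Q, hQ⟩⟩

theorem IsTransportBall.eventually_transportJoined (hf : ContMDiff 𝓘(ℝ, F) 𝓘(ℝ, E) ∞ f) {p₀ : M}
    {r : ℝ} {A : F → E →L[ℝ] F →L[ℝ] E} (hA : IsTransportBall nabla f p₀ r A) :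
    ∀ᶠ p in 𝓝 p₀, TransportJoined nabla F f p₀ p := by
  filter_upwards [hA.preimage_mem_nhds] with p hp
  have h := hA.transportJoined hf (Metric.mem_ball_self hA.pos) hp.2
  rwa [extChartAt_to_inv, (extChartAt 𝓘(ℝ, F) p₀).left_inv hp.1] at h

/-- Segment transport from `y` to any `y'` in the ball carries the field to itself, so its
coordinates are joined by a solution of the segment ODE, as `hasFDerivAt_of_forall_segment`
requires. -/
theorem IsTransportBall.hasFDerivAt (hf : ContMDiff 𝓘(ℝ, F) 𝓘(ℝ, E) ∞ f) {p₀ : M} {r : ℝ}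
    {A : F → E →L[ℝ] F →L[ℝ] E} (hA : IsTransportBall nabla f p₀ r A) {x : M}
    {W : TangentSpace 𝓘(ℝ, E) (f x)}
    (hW : MulAction.stabilizer (relHolonomy (F := F) nabla f x) W = ⊤) {u : F → E}
    (hu : ∀ y, u y = (trivializationAt E (TangentSpace 𝓘(ℝ, E)) (f p₀)
      ⟨f ((extChartAt 𝓘(ℝ, F) p₀).symm y),
        transportField nabla F f x W ((extChartAt 𝓘(ℝ, F) p₀).symm y)⟩).2) {y : F}
    (hy : y ∈ Metric.ball (extChartAt 𝓘(ℝ, F) p₀ p₀) r) :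
    HasFDerivAt u (A y (u y)) y := by
  have hb := Metric.isOpen_ball.mem_nhds hy
  refine hasFDerivAt_of_forall_segment hb (hA.contDiffOn.continuousOn.continuousAt hb)
    fun y' hy' ↦ ?_
  obtain ⟨P, hP, hv⟩ := hA.exists_isPathTransport hf hy hy'
  obtain ⟨v, hv0, hv1, hv⟩ := hv (transportField nabla F f x W ((extChartAt 𝓘(ℝ, F) p₀).symm y))
  refine ⟨v, by rw [hv0, hu], ?_, hv⟩
  rw [hv1, hu, (hA.transportJoined hf hy hy').transportField_trans hW hP]

variable [FiniteDimensional ℝ F] [T2Space N]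

/-- Being joined is symmetric and transitive, and it holds near each point by transport along
segments. -/
theorem transportJoined_of_preconnectedSpace [PreconnectedSpace M]
    (hnabla : nabla.ContMDiffCovariantDerivative ∞) (hf : ContMDiff 𝓘(ℝ, F) 𝓘(ℝ, E) ∞ f)
    (x p : M) : TransportJoined nabla F f x p := by
  refine isPreconnected_univ.induction₂' _ (fun x _ ↦ ?_)
    (fun _ _ _ _ _ _ h h' ↦ h.trans h') (mem_univ x) (mem_univ p)
  obtain ⟨r, A, hA⟩ := exists_isTransportBall nabla f hnabla hf x
  rw [nhdsWithin_univ]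
  filter_upwards [hA.eventually_transportJoined hf] with y hy
  exact ⟨hy, hy.symm⟩

/-- Around each `p₀` the coordinates `u` satisfy `du = A(·)(u)`. This gives smoothness, and its
value at `φ p₀`, pulled back by the chart, is the equation `∇_w X = 0`. -/
theorem isParallelField_transportField
    (hnabla : nabla.ContMDiffCovariantDerivative ∞) (hf : ContMDiff 𝓘(ℝ, F) 𝓘(ℝ, E) ∞ f)
    {x : M} {W : TangentSpace 𝓘(ℝ, E) (f x)}
    (hW : MulAction.stabilizer (relHolonomy (F := F) nabla f x) W = ⊤) :
    IsParallelField (F := F) nabla f fun p ↦ ⟨f p, transportField nabla F f x W p⟩ := by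
  obtain ⟨X, hX⟩ : ∃ X : M → TangentBundle 𝓘(ℝ, E) N,
    X = fun p ↦ ⟨f p, transportField nabla F f x W p⟩ := ⟨_, rfl⟩
  rw [← hX]
  have hXf (p : M) : (X p).proj = f p := by rw [hX]
  suffices ∀ p₀ : M, ContMDiffAt 𝓘(ℝ, F) (𝓘(ℝ, E).prod 𝓘(ℝ, E)) ∞ X p₀ ∧
    ∀ w : TangentSpace 𝓘(ℝ, F) p₀, covDerivWithin nabla X univ p₀ w = 0 from
      ⟨hXf, fun p ↦ (this p).1, fun p ↦ (this p).2⟩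
  intro p₀
  obtain ⟨r, A, hA⟩ := exists_isTransportBall nabla f hnabla hf p₀
  set φ := extChartAt 𝓘(ℝ, F) p₀ with hφ
  set e := trivializationAt E (TangentSpace 𝓘(ℝ, E)) (f p₀) with he
  obtain ⟨u, hu⟩ : ∃ u : F → E, u = fun y ↦ (e (X (φ.symm y))).2 := ⟨_, rfl⟩
  have hd (y : F) (hy : y ∈ Metric.ball (φ p₀) r) : HasFDerivAt u (A y (u y)) y :=
    hA.hasFDerivAt hf hW (fun y ↦ by rw [hu, hX]) hy
  have hus : ContDiffOn ℝ ∞ u (Metric.ball (φ p₀) r) :=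
    contDiffOn_of_hasFDerivWithinAt_linear Metric.isOpen_ball.uniqueDiffOn hA.contDiffOn
      fun y hy ↦ (hd y hy).hasFDerivWithinAt
  have hb : Metric.ball (φ p₀) r ∈ 𝓝 (φ p₀) := Metric.ball_mem_nhds _ hA.pos
  have hm : f p₀ ∈ e.baseSet := FiberBundle.mem_baseSet_trivializationAt' _
  have hm' : X p₀ ∈ e.source := e.mem_source.2 (by rwa [hXf])
  have hXu : (fun p ↦ (e (X p)).2) =ᶠ[𝓝 p₀] u ∘ φ := by
    filter_upwards [hA.preimage_mem_nhds] with p hp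
    rw [hu, Function.comp_apply, φ.left_inv hp.1]
  have hφs : ContMDiffAt 𝓘(ℝ, F) 𝓘(ℝ, F) ∞ φ p₀ := contMDiffAt_extChartAt
  have huφ : ContMDiffAt 𝓘(ℝ, F) 𝓘(ℝ, E) ∞ (u ∘ φ) p₀ :=
    (hus.contDiffAt hb).contMDiffAt.comp p₀ hφs
  have hXs : ContMDiffAt 𝓘(ℝ, F) (𝓘(ℝ, E).prod 𝓘(ℝ, E)) ∞ X p₀ := by
    refine (e.contMDiffAt_iff hm').2 ⟨?_, huφ.congr_of_eventuallyEq hXu⟩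
    simp only [hXf]
    exact hf p₀
  refine ⟨hXs, fun w ↦ ?_⟩
  have hXp : (X p₀).proj ∈ e.baseSet := e.mem_source.1 hm'
  refine (covDerivWithin_eq_zero_iff (e := e) (hXs.mdifferentiableAt (by simp)).mdifferentiableWithinAt
    (uniqueMDiffWithinAt_univ _) hXp w).2 ?_
  have hφp : φ.symm (φ p₀) = p₀ := extChartAt_to_inv p₀
  have hφd : MDifferentiableAt 𝓘(ℝ, F) 𝓘(ℝ, F) φ p₀ := hφs.mdifferentiableAt (by simp)
  obtain ⟨w', hw'⟩ : ∃ w' : F, w' = mfderiv 𝓘(ℝ, F) 𝓘(ℝ, F) φ p₀ w := ⟨_, rfl⟩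
  have h1 : mvfderivWithin 𝓘(ℝ, F) (fun p ↦ (e (X p)).2) univ p₀ w = A (φ p₀) (u (φ p₀)) w' := by
    rw [mvfderivWithin_univ, mvfderiv_congr_of_eventuallyEq hXu]
    have h := DFunLike.congr_fun (mfderiv_comp (I := 𝓘(ℝ, F)) (I' := 𝓘(ℝ, F)) (I'' := 𝓘(ℝ, E)) p₀
      ((hd _ (mem_of_mem_nhds hb)).differentiableAt.mdifferentiableAt) hφd) w
    refine h.trans ?_
    rw [hw']
    exact DFunLike.congr_fun ((hd _ (mem_of_mem_nhds hb)).hasMFDerivAt.mfderiv) _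
  have hg : MDifferentiableAt 𝓘(ℝ, F) 𝓘(ℝ, E) (f ∘ φ.symm) (φ p₀) :=
    (hf.comp_contMDiffOn (contMDiffOn_extChartAt_symm p₀)).contMDiffAt
      (extChartAt_target_mem_nhds p₀) |>.mdifferentiableAt (by simp)
  have h2 : mfderivWithin 𝓘(ℝ, F) 𝓘(ℝ, E) (fun p ↦ (X p).proj) univ p₀ w =
      mfderiv 𝓘(ℝ, F) 𝓘(ℝ, E) (f ∘ φ.symm) (φ p₀) w' := by
    have h := DFunLike.congr_fun (mfderiv_comp (I := 𝓘(ℝ, F)) (I' := 𝓘(ℝ, F)) (I'' := 𝓘(ℝ, E)) p₀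
      hg hφd) w
    have h' : (fun p ↦ (X p).proj) =ᶠ[𝓝 p₀] (f ∘ φ.symm) ∘ φ := by
      filter_upwards [extChartAt_source_mem_nhds (I := 𝓘(ℝ, F)) p₀] with p hp
      rw [hXf, Function.comp_apply, Function.comp_apply, φ.left_inv hp]
    rw [hw']
    refine Eq.trans ?_ h
    refine (DFunLike.congr_fun (congrFun (mfderivWithin_univ (I := 𝓘(ℝ, F)) (I' := 𝓘(ℝ, E))) p₀)
      w).trans ?_
    exact DFunLike.congr_fun h'.mfderiv_eq w
  have h3 (q q' : N) (hq : q = q') (a a' b b' : E) (ha : a = a') (hb : b = b') :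
      -(e ⟨q, nabla (fun z ↦ e.symm z a) q b⟩).2 = -(e ⟨q', nabla (fun z ↦ e.symm z a') q' b'⟩).2 := by
    subst hq ha hb
    rfl
  rw [h1]
  refine (hA.apply_eq (φ p₀) (mem_of_mem_nhds hb) (u (φ p₀)) w').trans (h3 _ _ ?_ _ _ _ _ ?_ h2.symm)
  · rw [hφp, hXf]
  · simp only [hu, hφp]

/-- The value at `x` is itself a transport of `W` around some loop, so invariance is needed to
recover `W`. -/
theorem transportField_self
    (hnabla : nabla.ContMDiffCovariantDerivative ∞) (hf : ContMDiff 𝓘(ℝ, F) 𝓘(ℝ, E) ∞ f)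
    {x : M} {W : TangentSpace 𝓘(ℝ, E) (f x)}
    (hW : MulAction.stabilizer (relHolonomy (F := F) nabla f x) W = ⊤) :
    (⟨f x, transportField nabla F f x W x⟩ : TangentBundle 𝓘(ℝ, E) N) = ⟨f x, W⟩ := by
  obtain ⟨r, A, hA⟩ := exists_isTransportBall nabla f hnabla hf x
  have hx := (hA.eventually_transportJoined hf).self_of_nhds
  obtain ⟨P, hP⟩ := hx.1
  rw [hx.transportField_eq hW hP, stabilizer_relHolonomy_eq_top_iff.1 hW P hP]

end Existence

end ParallelAlong

theorem mainTheorem2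
    {E : Type*} [NormedAddCommGroup E] [NormedSpace ℝ E] [FiniteDimensional ℝ E]
    {N : Type*} [TopologicalSpace N] [T2Space N] [ChartedSpace E N] [IsManifold 𝓘(ℝ, E) ∞ N]
    [RiemannianBundle (fun y : N ↦ TangentSpace 𝓘(ℝ, E) y)]
    [IsContMDiffRiemannianBundle 𝓘(ℝ, E) ∞ E (fun y : N ↦ TangentSpace 𝓘(ℝ, E) y)]
    (nabla : CovariantDerivative 𝓘(ℝ, E) E (fun y : N ↦ TangentSpace 𝓘(ℝ, E) y))
    (hnabla : ParallelAlong.IsLeviCivita nabla)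
    {F : Type*} [NormedAddCommGroup F] [NormedSpace ℝ F] [FiniteDimensional ℝ F]
    {M : Type*} [TopologicalSpace M] [T2Space M] [ChartedSpace F M] [IsManifold 𝓘(ℝ, F) ∞ M]
    (f : M → N) (hf : IsImmersion 𝓘(ℝ, F) 𝓘(ℝ, E) ∞ f) (hf_inj : Function.Injective f)
    (x : M) :
    (∀ W : TangentSpace 𝓘(ℝ, E) (f x),
      (∃ X : M → TangentBundle 𝓘(ℝ, E) N,
        ParallelAlong.IsParallelField (F := F) nabla f X ∧ X x = ⟨f x, W⟩) ↔
      MulAction.stabilizer (ParallelAlong.relHolonomy (F := F) nabla f x) W = ⊤) ∧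
    (ConnectedSpace M →
      ((∃ X : M → TangentBundle 𝓘(ℝ, E) N,
        ParallelAlong.IsParallelField (F := F) nabla f X ∧ ∃ p, (X p).2 ≠ 0) ↔
      ∃ W : TangentSpace 𝓘(ℝ, E) (f x), W ≠ 0 ∧
        MulAction.stabilizer (ParallelAlong.relHolonomy (F := F) nabla f x) W = ⊤)) := by
  have hs := hnabla.smooth
  have hfs : ContMDiff 𝓘(ℝ, F) 𝓘(ℝ, E) ∞ f := hf.contMDiff
  have ha (W : TangentSpace 𝓘(ℝ, E) (f x)) : (∃ X : M → TangentBundle 𝓘(ℝ, E) N,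
        ParallelAlong.IsParallelField (F := F) nabla f X ∧ X x = ⟨f x, W⟩) ↔
      MulAction.stabilizer (ParallelAlong.relHolonomy (F := F) nabla f x) W = ⊤ := by
    constructor
    · rintro ⟨X, hX, hXW⟩
      refine ParallelAlong.stabilizer_relHolonomy_eq_top_iff.2 fun P hP ↦ ?_
      have h := (hX.eq_of_isPathTransport hs hP hXW).symm.trans hXW
      simpa using h
    · exact fun hW ↦ ⟨_, ParallelAlong.isParallelField_transportField hs hfs hW,
        ParallelAlong.transportField_self hs hfs hW⟩
  refine ⟨ha, fun _ ↦ ⟨?_, ?_⟩⟩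
  · rintro ⟨X, hX, p, hp⟩
    obtain ⟨W, hW⟩ : ∃ W : TangentSpace 𝓘(ℝ, E) (f x), X x = ⟨f x, W⟩ := by
      rw [← hX.proj_eq x]
      exact ⟨(X x).2, rfl⟩
    refine ⟨W, ?_, (ha W).1 ⟨X, hX, hW⟩⟩
    rintro rfl
    -- Were the value at `x` zero, transport to `p` would give zero there too.
    obtain ⟨P, hP⟩ := (ParallelAlong.transportJoined_of_preconnectedSpace (F := F) hs hfs x p).1
    have h := hX.eq_of_isPathTransport hs hP hW
    rw [h, map_zero] at hp
    exact hp rfl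
  · rintro ⟨W, hW, hG⟩
    obtain ⟨X, hX, hXW⟩ := (ha W).2 hG
    refine ⟨X, hX, x, ?_⟩
    rwa [hXW]
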